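/- Let $n\ge 1$. Put $[n]=\{1,\dots,n\}$ and $[[n]]=\{1,\bar 1,\dots,n,\bar n\}$, with the involution $i\leftrightarrow\bar i$, and $\overline X=\{\bar x: x\in X\}$ for $X\subseteq[[n]]$. Let $\Sigma$ be a finite totally ordered set (of signs). **The posets.** A $\Sigma$-labeled partition $\pi$ of $[[n]]$ is a partition of $[[n]]$ into nonempty blocks, together with an injection from a subset of its blocks (the signed blocks) to $\Sigma$, such that $\overline R$ is a block whenever $R$ is, and a block $S$ is signed if and only if $S=\overline S$. Write $\pi_\sigma$ for the block labeled $\sigma$ ($\pi_\sigma=\emptyset$ if there is none) and $\Sigma(\pi)$ for the set of labels that occur. Put $\pi\preceq\psi$ if $\pi_\sigma\subseteq\psi_\sigma$ for all $\sigma$ and every unsigned block of $\pi$ is contained in a block of $\psi$. Let $\Pi_{n,\Sigma}$ be the poset of all $\Sigma$-labeled partitions of $[[n]]$ with a new top element $\hat 1$ added. Let $\hat 0$ be the partition into singletons and $[n]_\sigma$ the partition with the single block $[[n]]$, labeled $\sigma$. The subposet of type $C_n$ is $\Pi_{n,\Sigma}$; that of type $D_n$ consists of $\hat 1$ and all $x\neq\hat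 1$ with $|x_\sigma|\ne 2$ for all $\sigma\in\Sigma$; that of type $B_n$ (with a distinguished sign $\bar\sigma\in\Sigma$) consists of $\hat 1$ and all $x\neq\hat1$ with $|x_\sigma|\neq 2$ for all $\sigma\neq\bar\sigma$. **The edge labeling.** The representative $r(R)$ of a block $R$ is the least $i\in[n]$ with $i\in R$ or $\bar i\in R$, and $R$ is normalized if $r(R)\in R$. Each edge $x\prec\!\cdot\, y$ of the Hasse diagram of $\Pi_{n,\Sigma}$ gets a label $\lambda(x,y)\in\mathbb N\times\mathbb N$, where labels are ordered lexicographically: * $(0,\max(r(R),r(R')))$ if $R\cup R'\in y$ for distinct normalized unsigned blocks $R,R'$ of $x$; * $(2,\min(r(R),r(R')))$ if $R\cup\overline{R'}\in y$ for distinct normalized unsigned blocks $R,R'$ of $x$; * if $x_\sigma\subsetneq y_\sigma$: $(1,|\{\tau\in\Sigma(x):\tau\le\sigma\}|)$ when $\sigma\in\Sigma(x)$, and $(1,|\{\tau\in\Sigma:\tau\le\sigma\}\cup\Sigma(x)|)$ when $\sigma\notin\Sigma(x)$; * $(1,2)$ if $y=\hat 1$. A maximal chain $x_0\prec\!\cdot\,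 x_1\prec\!\cdot\,\cdots\prec\!\cdot\, x_t$ from $x_0$ to $x_t$ in a subposet (the covering relation being that of the subposet) is decreasing if $\lambda(x_0,x_1)\ge\lambda(x_1,x_2)\ge\cdots\ge\lambda(x_{t-1},x_t)$. **Theorem (linear case).** Let $|\Sigma|=1$, $\Sigma=\{\sigma\}$. The number of decreasing maximal chains from $\hat 0$ to $[n]_\sigma$ in the subposet of $\Pi_{n,\{\sigma\}}$ of type $B_n$, $C_n$ or $D_n$ equals $$\sum_{\pi=\pi_1\mid\cdots\mid\pi_k} f(\pi)\,(2|\pi_1|-3)!!\cdots(2|\pi_k|-3)!!,$$ where the sum runs over all partitions $\pi$ of $[n]$ into nonempty blocks, $k$ is the number of blocks of $\pi$, $s$ is the number of its blocks with more than one element, $(-1)!!=1$, and * $f(\pi)=k!$ for types $B_n$ and $C_n$ (the subposets of these two types coincide); * $f(\pi)=s\cdot(k-1)!$ for type $D_n$. (For $n=1$ the element $[1]_\sigma$ does not belong to the subposet of type $D_1$; there are no such chains, and the sum is $0$.) -/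

import Mathlib

open Finset
open scoped Nat

/-- The set `[[n]] = {1, 1̄, …, n, n̄}`: the pair `(i, false)` is the number `i + 1`, and the pair
`(i, true)` is its barred copy. -/
abbrev DoubleSet (n : ℕ) : Type := Fin n × Bool

/-- The set `X̄ = {x̄ | x ∈ X}`. -/
def barSet {n : ℕ} (X : Finset (DoubleSet n)) : Finset (DoubleSet n) :=
  X.image fun x => (x.1, !x.2)

/-- A `Sg`-labeled partition of `[[n]]`: a partition of `[[n]]` together with a set of signed
blocks (those whose label is not `none`) and an injection from the signed blocks to `Sg`, such that
the partition is stable under the bar involution and the signed blocks are exactly the blocks that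
are equal to their bar. Sets that are not blocks have the label `none`. -/
@[ext]
structure LabeledPartition (n : ℕ) (Sg : Type*) where
  part : Finpartition (univ : Finset (DoubleSet n))
  label : Finset (DoubleSet n) → Option Sg
  label_of_notMem : ∀ B, B ∉ part.parts → label B = none
  label_injective : ∀ B B' σ, label B = some σ → label B' = some σ → B = B'
  barSet_mem : ∀ B ∈ part.parts, barSet B ∈ part.parts
  barSet_eq_iff : ∀ B ∈ part.parts, (B = barSet B ↔ ∃ σ, label B = some σ)

namespace LabeledPartition

variable {n : ℕ} {Sg : Type*}

/-- `R` is an unsigned block of `π`. -/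
def IsUnsigned (π : LabeledPartition n Sg) (R : Finset (DoubleSet n)) : Prop :=
  R ∈ π.part.parts ∧ π.label R = none

/-- The block `π_σ` of sign `σ`; it is empty if no block of `π` has the sign `σ`. -/
def signedBlock [DecidableEq Sg] (π : LabeledPartition n Sg) (σ : Sg) : Finset (DoubleSet n) :=
  univ.filter fun x => π.label (π.part.part x) = some σ

/-- The sign `Σ(π)` of `π`, the set of signs that occur in `π`. -/
def signs [Fintype Sg] [DecidableEq Sg] (π : LabeledPartition n Sg) : Finset Sg :=
  univ.filter fun σ => (π.signedBlock σ).Nonempty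

theorem label_eq_some_mem (π : LabeledPartition n Sg) {B : Finset (DoubleSet n)} {σ : Sg}
    (h : π.label B = some σ) : B ∈ π.part.parts := by
  by_contra hB
  rw [π.label_of_notMem B hB] at h
  simp at h

theorem signedBlock_eq [DecidableEq Sg] (π : LabeledPartition n Sg) {B : Finset (DoubleSet n)}
    {σ : Sg} (h : π.label B = some σ) : π.signedBlock σ = B := by
  have hB := π.label_eq_some_mem h
  ext x
  simp only [signedBlock, mem_filter, mem_univ, true_and]
  constructor
  · intro hx
    rw [← π.label_injective _ _ σ hx h]
    exact π.part.mem_part (mem_univ x)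
  · intro hx
    rw [π.part.part_eq_of_mem hB hx]
    exact h

theorem label_signedBlock [DecidableEq Sg] (π : LabeledPartition n Sg) {σ : Sg}
    (h : (π.signedBlock σ).Nonempty) : π.label (π.signedBlock σ) = some σ := by
  obtain ⟨x, hx⟩ := h
  simp only [signedBlock, mem_filter, mem_univ, true_and] at hx
  rw [π.signedBlock_eq hx]
  exact hx

/-- `π ⪯ ψ` (`π` is a refinement of `ψ`): the block of `π` of each sign is contained in the block
of `ψ` of the same sign, and each unsigned block of `π` is contained in some block of `ψ` (then
the bar of the former is contained in the bar of the latter). -/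
def Refines [DecidableEq Sg] (π ψ : LabeledPartition n Sg) : Prop :=
  (∀ σ, π.signedBlock σ ⊆ ψ.signedBlock σ) ∧
    ∀ R, π.IsUnsigned R → ∃ T ∈ ψ.part.parts, R ⊆ T

theorem Refines.exists_part [DecidableEq Sg] {π ψ : LabeledPartition n Sg} (h : π.Refines ψ)
    {B : Finset (DoubleSet n)} (hB : B ∈ π.part.parts) : ∃ T ∈ ψ.part.parts, B ⊆ T := by
  cases hl : π.label B with
  | none => exact h.2 B ⟨hB, hl⟩
  | some σ =>
    have hs := h.1 σ
    rw [π.signedBlock_eq hl] at hs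
    exact ⟨_, ψ.label_eq_some_mem
      (ψ.label_signedBlock ((π.part.nonempty_of_mem_parts hB).mono hs)), hs⟩

theorem Refines.label_eq [DecidableEq Sg] {π ψ : LabeledPartition n Sg} (h : π.Refines ψ)
    (hp : π.part = ψ.part) {B : Finset (DoubleSet n)} {σ : Sg} (hl : π.label B = some σ) :
    ψ.label B = some σ := by
  have hB := π.label_eq_some_mem hl
  have hs := h.1 σ
  rw [π.signedBlock_eq hl] at hs
  obtain ⟨x, hx⟩ := π.part.nonempty_of_mem_parts hB
  have hψ := ψ.label_signedBlock ⟨x, hs hx⟩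
  have h2 : ψ.signedBlock σ = B :=
    ψ.part.eq_of_mem_parts (ψ.label_eq_some_mem hψ) (hp ▸ hB) (hs hx) hx
  rwa [h2] at hψ

instance [DecidableEq Sg] : PartialOrder (LabeledPartition n Sg) where
  le := Refines
  le_refl π := ⟨fun _ => Subset.rfl, fun R hR => ⟨R, hR.1, Subset.rfl⟩⟩
  le_trans π ψ θ h1 h2 := by
    refine ⟨fun σ => (h1.1 σ).trans (h2.1 σ), fun R hR => ?_⟩
    obtain ⟨T, hT, hRT⟩ := h1.2 R hR
    obtain ⟨U, hU, hTU⟩ := h2.exists_part hT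
    exact ⟨U, hU, hRT.trans hTU⟩
  le_antisymm π ψ h1 h2 := by
    have hp : π.part = ψ.part :=
      le_antisymm (fun B hB => h1.exists_part hB) (fun B hB => h2.exists_part hB)
    refine LabeledPartition.ext hp (funext fun B => Option.ext fun σ => ?_)
    exact ⟨fun h => h1.label_eq hp h, fun h => h2.label_eq hp.symm h⟩

theorem barSet_singleton_ne (x : DoubleSet n) : ({x} : Finset (DoubleSet n)) ≠ barSet {x} := by
  rcases x with ⟨i, b⟩
  cases b <;> simp [barSet]

/-- The finest partition `0̂ = 1 | 1̄ | ⋯ | n | n̄`. -/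
def finest (n : ℕ) (Sg : Type*) : LabeledPartition n Sg where
  part := ⊥
  label _ := none
  label_of_notMem _ _ := rfl
  label_injective _ _ _ h := by simp at h
  barSet_mem B hB := by
    obtain ⟨x, -, rfl⟩ := (Finpartition.mem_bot_iff).1 hB
    exact Finpartition.mem_bot_iff.2 ⟨(x.1, !x.2), mem_univ _, by simp [barSet]⟩
  barSet_eq_iff B hB := by
    obtain ⟨x, -, rfl⟩ := (Finpartition.mem_bot_iff).1 hB
    simpa using barSet_singleton_ne x

theorem univ_ne_bot (hn : 0 < n) : (univ : Finset (DoubleSet n)) ≠ ⊥ :=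
  Nonempty.ne_empty ⟨(⟨0, hn⟩, false), mem_univ _⟩

theorem barSet_univ : barSet (univ : Finset (DoubleSet n)) = univ := by
  ext x
  simp only [barSet, mem_image, mem_univ, true_and, iff_true]
  exact ⟨(x.1, !x.2), by simp⟩

/-- The labeled partition `[n]_σ`, whose only block is `[[n]]`, with the sign `σ`. -/
def full (n : ℕ) (hn : 0 < n) {Sg : Type*} (σ : Sg) : LabeledPartition n Sg where
  part := Finpartition.indiscrete (univ_ne_bot hn)
  label B := if B = univ then some σ else none
  label_of_notMem B hB := by simpa using hB
  label_injective B B' τ h h' := by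
    split_ifs at h h' with h1 h2
    rw [h1, h2]
  barSet_mem B hB := by
    rw [Finpartition.indiscrete_parts, mem_singleton] at hB ⊢
    rw [hB, barSet_univ]
  barSet_eq_iff B hB := by
    rw [Finpartition.indiscrete_parts, mem_singleton] at hB
    simp [hB, barSet_univ]

end LabeledPartition

/-- The poset `Π_{n,Sg}` of all `Sg`-labeled partitions of `[[n]]`, with a new top element `⊤`. -/
abbrev LabeledPartitionPoset (n : ℕ) (Sg : Type*) : Type _ := WithTop (LabeledPartition n Sg)

section Types

variable (n : ℕ) {Sg : Type*} [DecidableEq Sg]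

/-- The subposet of type `B_n` with the distinguished sign `σbar`: the top element, and all `x` such
that `|x_σ| ≠ 2` for all signs `σ ≠ σbar`. -/
def typeB (σbar : Sg) : Set (LabeledPartitionPoset n Sg) :=
  {x | ∀ π : LabeledPartition n Sg, x = (π : LabeledPartitionPoset n Sg) →
    ∀ σ, σ ≠ σbar → (π.signedBlock σ).card ≠ 2}

/-- The subposet of type `C_n`, which is all of `Π_{n,Sg}`. -/
def typeC (Sg : Type*) : Set (LabeledPartitionPoset n Sg) := Set.univ

/-- The subposet of type `D_n`: the top element, and all `x` such that `|x_σ| ≠ 2` for all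
signs `σ`. -/
def typeD (Sg : Type*) [DecidableEq Sg] : Set (LabeledPartitionPoset n Sg) :=
  {x | ∀ π : LabeledPartition n Sg, x = (π : LabeledPartitionPoset n Sg) →
    ∀ σ, (π.signedBlock σ).card ≠ 2}

end Types

/-- The representative `r(R)` of a nonempty set `R`: the least number `i` in `{1, …, n}` such that
`i ∈ R` or `ī ∈ R`. -/
noncomputable def representative {n : ℕ} (R : Finset (DoubleSet n)) : ℕ :=
  sInf {i : ℕ | ∃ x ∈ R, (x.1 : ℕ) + 1 = i}

/-- `R` is normalized: its representative (and not only the bar of it) belongs to `R`. -/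
def IsNormalized {n : ℕ} (R : Finset (DoubleSet n)) : Prop :=
  ∃ i : Fin n, (i : ℕ) + 1 = representative R ∧ (i, false) ∈ R

/-- `IsEdgeLabel x y ℓ`: the edge from `x` to `y` of the Hasse diagram of `Π_{n,Sg}` has the
label `ℓ`. The four cases are those of coherent edges, non-coherent edges, edges of sign `σ`, and
edges to the top element. The labels are ordered lexicographically. -/
inductive IsEdgeLabel {n : ℕ} {Sg : Type*} [Fintype Sg] [LinearOrder Sg] :
    LabeledPartitionPoset n Sg → LabeledPartitionPoset n Sg → ℕ ×ₗ ℕ → Prop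
  | coherent (x y : LabeledPartition n Sg) (R R' : Finset (DoubleSet n))
      (hR : x.IsUnsigned R) (hR' : x.IsUnsigned R') (hne : R ≠ R')
      (hN : IsNormalized R) (hN' : IsNormalized R') (hy : R ∪ R' ∈ y.part.parts) :
      IsEdgeLabel x y (toLex (0, max (representative R) (representative R')))
  | nonCoherent (x y : LabeledPartition n Sg) (R R' : Finset (DoubleSet n))
      (hR : x.IsUnsigned R) (hR' : x.IsUnsigned R') (hne : R ≠ R')
      (hN : IsNormalized R) (hN' : IsNormalized R') (hy : R ∪ barSet R' ∈ y.part.parts) :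
      IsEdgeLabel x y (toLex (2, min (representative R) (representative R')))
  | oldSign (x y : LabeledPartition n Sg) (σ : Sg)
      (h : x.signedBlock σ ⊂ y.signedBlock σ) (hσ : σ ∈ x.signs) :
      IsEdgeLabel x y (toLex (1, (x.signs.filter fun τ => τ ≤ σ).card))
  | newSign (x y : LabeledPartition n Sg) (σ : Sg)
      (h : x.signedBlock σ ⊂ y.signedBlock σ) (hσ : σ ∉ x.signs) :
      IsEdgeLabel x y (toLex (1, ((univ.filter fun τ => τ ≤ σ) ∪ x.signs).card))
  | top (x : LabeledPartition n Sg) : IsEdgeLabel x ⊤ (toLex (1, 2))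

/-- The edge labeling `λ` of `Π_{n,Sg}`. It is meaningful for `x ⋖ y`, where there is exactly one
label in the sense of `IsEdgeLabel`. -/
noncomputable def edgeLabel {n : ℕ} {Sg : Type*} [Fintype Sg] [LinearOrder Sg]
    (x y : LabeledPartitionPoset n Sg) : ℕ ×ₗ ℕ :=
  Classical.epsilon (IsEdgeLabel x y)

/-- The word `λ(c)` of labels of the successive edges of a chain `c`. -/
noncomputable def labelWord {n : ℕ} {Sg : Type*} [Fintype Sg] [LinearOrder Sg]
    (c : List (LabeledPartitionPoset n Sg)) : List (ℕ ×ₗ ℕ) :=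
  List.zipWith edgeLabel c c.tail

/-- The set of decreasing maximal chains from `x` to `y` in the subposet `Q` of `Π_{n,Sg}`: the
chains `x ⋖ z₁ ⋖ ⋯ ⋖ z_t ⋖ y` of covers in `Q`, from `x` to `y`, whose word of labels is weakly
decreasing. -/
def decreasingMaximalChains {n : ℕ} {Sg : Type*} [Fintype Sg] [LinearOrder Sg]
    (Q : Set (LabeledPartitionPoset n Sg)) (x y : LabeledPartitionPoset n Sg) : Set (List Q) :=
  {c | c.IsChain (· ⋖ ·) ∧ (c.map Subtype.val).head? = some x ∧
    (c.map Subtype.val).getLast? = some y ∧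
    (labelWord (c.map Subtype.val)).Pairwise (· ≥ ·)}

/-- The sum over all partitions `π = π₁ | ⋯ | π_k` of an `n`-element set of
`f(π) ⬝ (2|π₁| - 3)!! ⋯ (2|π_k| - 3)!!`. For a block of size `1` the truncated difference
`2 * 1 - 3 = 0` gives `0!! = 1`, which is the usual value of `(-1)!!`. -/
def partitionSum (n : ℕ) (f : Finpartition (univ : Finset (Fin n)) → ℕ) : ℕ :=
  ∑ π : Finpartition (univ : Finset (Fin n)), f π * ∏ B ∈ π.parts, (2 * B.card - 3)‼

/-- The number `s` of nonsingleton blocks of `π`. -/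
def numNonsingleton {n : ℕ} (π : Finpartition (univ : Finset (Fin n))) : ℕ :=
  (π.parts.filter fun B => B.card ≠ 1).card

/-! Every cover below the top either joins two unsigned blocks (together with the joined bars) or
absorbs an unsigned block and its bar into the signed block (`LabeledPartition.covBy_iff`); with a
single sign, all edges of the second kind have the label `(1, 1)`. A decreasing chain cannot contain
a coherent join: an unsigned block remains after it, and absorbing that block later needs a label
`(1, 1)`, which exceeds every `(0, b)` (`encard_chainsFrom_coherent`). So a decreasing chain from
the bottom to `[n]_σ` consists of noncoherent joins followed by signed edges.

If `k` pairs of unsigned blocks remain when the signed edges begin, the first one may absorb any of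
them, except that type D forbids a pair of singletons. The other `k - 1` are then absorbed in any
order, since the signed block already has more than two elements or the type imposes no restriction.
This gives `k!` or `s * (k - 1)!` completions (`encard_chainsFrom_signed`, `signedCompletions`).

For least elements `a < b` there is exactly one noncoherent join, and its label depends only on `a`.
Hence the joins can be followed on the induced partitions of `[n]` alone, encoded by `MinMap`. The
labels decrease exactly when each `a` is at most the least element of every nonsingleton block
present, which is the condition in `MinMap.admissible`.

It remains to see that the admissible merge sequences from singletons to `p` number `∏ (2|B| -
3)!!`. The last merge has as its `a` the smallest least element of a nonsingleton block, and it is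
undone by detaching a nonempty subset of that block that avoids `a`. The product obeys the same
recurrence (`MinMap.weight_eq_sum_admissible`), by a convolution identity for double factorials that
reduces to the Catalan recurrence (`sum_choose_mul_doubleFactorial`). `MinMap.mergeSum_discrete`
turns this into the sum over partitions. -/

/-! ### Double factorials and Catalan numbers. -/

theorem two_pow_mul_doubleFactorial_eq_catalan (i : ℕ) :
    2 ^ i * (2 * (i + 1) - 3)‼ = (i + 1)! * catalan i := by
  induction i with
  | zero => simp
  | succ i ih =>
    have h1 : (2 * (i + 1 + 1) - 3)‼ = (2 * i + 1) * (2 * (i + 1) - 3)‼ := by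
      cases i with
      | zero => simp
      | succ j =>
        rw [show 2 * (j + 1 + 1 + 1) - 3 = (2 * j + 1) + 2 by omega, Nat.doubleFactorial_add_two,
          show 2 * (j + 1 + 1) - 3 = 2 * j + 1 by omega]
        ring
    have h2 := succ_mul_catalan_eq_centralBinom i
    have h3 := succ_mul_catalan_eq_centralBinom (i + 1)
    have h4 := Nat.succ_mul_centralBinom_succ i
    rw [← h2, ← h3] at h4
    -- The two-term Catalan recurrence, obtained from that of the central binomial coefficients by
    -- cancelling `i + 1`.
    have h5 : (i + 1 + 1) * catalan (i + 1) = 2 * (2 * i + 1) * catalan i := by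
      apply Nat.eq_of_mul_eq_mul_left (Nat.succ_pos i)
      rw [Nat.succ_eq_add_one, h4]
      ring
    rw [h1, Nat.factorial_succ, pow_succ]
    calc 2 ^ i * 2 * ((2 * i + 1) * (2 * (i + 1) - 3)‼)
        = 2 * (2 * i + 1) * (2 ^ i * (2 * (i + 1) - 3)‼) := by ring
      _ = (i + 1)! * (2 * (2 * i + 1) * catalan i) := by rw [ih]; ring
      _ = _ := by rw [← h5]; ring

/-- Multiplied by `2 ^ k`, each summand becomes `(k + 1)!` times a term of the Catalan convolution
with an extra factor `k - i + 1`. Combinatorially, a block of `k + 2` elements loses a nonempty set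
of size `i + 1` that avoids its least element. -/
theorem sum_choose_mul_doubleFactorial (k : ℕ) :
    ∑ i ∈ range (k + 1), (k + 1).choose (i + 1) *
      ((2 * (i + 1) - 3)‼ * (2 * (k + 1 - i) - 3)‼) = (2 * (k + 2) - 3)‼ := by
  have key : ∀ i ∈ range (k + 1), 2 ^ k * ((k + 1).choose (i + 1) *
      ((2 * (i + 1) - 3)‼ * (2 * (k + 1 - i) - 3)‼)) =
      (k + 1)! * ((k - i + 1) * (catalan i * catalan (k - i))) := by
    intro i hi
    have hi : i ≤ k := by simpa [Nat.lt_succ_iff] using hi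
    have h1 := two_pow_mul_doubleFactorial_eq_catalan i
    have h2 := two_pow_mul_doubleFactorial_eq_catalan (k - i)
    have h3 := Nat.choose_mul_factorial_mul_factorial (show i + 1 ≤ k + 1 by omega)
    rw [show k + 1 - (i + 1) = k - i by omega] at h3
    rw [show k + 1 - i = k - i + 1 by omega,
      show 2 ^ k = 2 ^ i * 2 ^ (k - i) by rw [← pow_add]; congr 1; omega, ← h3]
    calc _ = (k + 1).choose (i + 1) * ((2 ^ i * (2 * (i + 1) - 3)‼) *
          (2 ^ (k - i) * (2 * (k - i + 1) - 3)‼)) := by ring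
      _ = _ := by rw [h1, h2, Nat.factorial_succ (k - i)]; ring
  -- By the symmetry `i ↔ k - i` the factor `k - i + 1` may be averaged with `i + 1`, so it acts as
  -- the constant `(k + 2) / 2`.
  have hrefl : ∑ i ∈ range (k + 1), (k - i + 1) * (catalan i * catalan (k - i)) =
      ∑ i ∈ range (k + 1), (i + 1) * (catalan i * catalan (k - i)) := by
    rw [← Finset.sum_range_reflect]
    refine sum_congr rfl fun i hi => ?_
    have hi : i ≤ k := by simpa [Nat.lt_succ_iff] using hi
    rw [show k + 1 - 1 - i = k - i by omega, show k - (k - i) = i by omega]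
    ring
  have hcat : ∑ i ∈ range (k + 1), catalan i * catalan (k - i) = catalan (k + 1) := by
    rw [catalan_succ, Finset.sum_range]
  have h2 : 2 * ∑ i ∈ range (k + 1), (k - i + 1) * (catalan i * catalan (k - i)) =
      (k + 2) * catalan (k + 1) := by
    rw [two_mul]
    nth_rewrite 2 [hrefl]
    rw [← hcat, ← sum_add_distrib, mul_sum]
    refine sum_congr rfl fun i hi => ?_
    have hi : i ≤ k := by simpa [Nat.lt_succ_iff] using hi
    rw [← add_mul]
    congr 1
    omega
  apply Nat.eq_of_mul_eq_mul_left (show 0 < 2 ^ (k + 1) by positivity)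
  have h3 := two_pow_mul_doubleFactorial_eq_catalan (k + 1)
  rw [h3, pow_succ, mul_comm (2 ^ k) 2, mul_assoc, mul_sum, sum_congr rfl key, ← mul_sum,
    mul_left_comm, h2, Nat.factorial_succ (k + 1)]
  ring

/-! ### Partitions of `[n]` and their admissible merge sequences. -/

/-- A partition of `Fin n`, given by the map that sends each element to the least element of its
block. -/
@[ext]
structure MinMap (n : ℕ) where
  toFun : Fin n → Fin n
  map_le' : ∀ i, toFun i ≤ i
  idem' : ∀ i, toFun (toFun i) = toFun i

namespace MinMap

variable {n : ℕ}

instance : CoeFun (MinMap n) fun _ => Fin n → Fin n := ⟨toFun⟩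

theorem map_le (p : MinMap n) (i : Fin n) : p i ≤ i := p.map_le' i

@[simp] theorem idem (p : MinMap n) (i : Fin n) : p (p i) = p i := p.idem' i

theorem ext_apply {p q : MinMap n} (h : ∀ i, p i = q i) : p = q := MinMap.ext (funext h)

instance : Finite (MinMap n) :=
  Finite.of_injective (fun p => p.toFun) fun _ _ h => MinMap.ext h

noncomputable instance : Fintype (MinMap n) := Fintype.ofFinite _

instance : DecidableEq (MinMap n) := fun p q => decidable_of_iff (p.toFun = q.toFun)
  ⟨MinMap.ext, fun h => h ▸ rfl⟩

/-- The partition into singletons. -/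
def discrete (n : ℕ) : MinMap n := ⟨id, fun _ => le_rfl, fun _ => rfl⟩

@[simp] theorem discrete_apply (i : Fin n) : discrete n i = i := rfl

/-- The set of elements mapped to `r`: a block if `r` is a least element, and empty otherwise. -/
def fiber (p : MinMap n) (r : Fin n) : Finset (Fin n) := univ.filter fun i => p i = r

@[simp] theorem mem_fiber {p : MinMap n} {r i : Fin n} : i ∈ p.fiber r ↔ p i = r := by
  simp [fiber]

/-- The least elements of the blocks. -/
def roots (p : MinMap n) : Finset (Fin n) := univ.filter fun i => p i = i

@[simp] theorem mem_roots {p : MinMap n} {i : Fin n} : i ∈ p.roots ↔ p i = i := by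
  simp [roots]

/-- The product of `(2|B| - 3)!!` over the blocks `B`; empty fibers contribute `1`. -/
def weight (p : MinMap n) : ℕ := ∏ r, (2 * (p.fiber r).card - 3)‼

/-- Join the blocks with the least elements `a` and `b`, if `a < b`. -/
def merge (p : MinMap n) (a b : Fin n) : MinMap n where
  -- The value `p (min a b)` makes this a `MinMap` for all `a` and `b`; for least elements `a < b`
  -- it is `a`.
  toFun i := if p i = b then p (min a b) else p i
  map_le' i := by
    split_ifs with h
    · exact (p.map_le _).trans ((min_le_right a b).trans (h ▸ p.map_le i))
    · exact p.map_le i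
  idem' i := by
    by_cases h : p i = b
    · simp only [h, if_true, idem]
      split_ifs <;> simp
    · simp [h]

theorem merge_apply {p : MinMap n} {a b : Fin n} (ha : p a = a) (hab : a < b) (i : Fin n) :
    p.merge a b i = if p i = b then a else p i := by
  change (if p i = b then p (min a b) else p i) = _
  rw [min_eq_left hab.le, ha]

/-- Detach the set `S` from its block, if it is nonempty and contains no least elements. -/
def split (p : MinMap n) (S : Finset (Fin n)) : MinMap n :=
  if h : S.Nonempty ∧ ∀ i ∈ S, p i ≠ i then
    { toFun := fun i => if i ∈ S then S.min' h.1 else p i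
      map_le' := fun i => by
        split_ifs with hi
        · exact S.min'_le i hi
        · exact p.map_le i
      idem' := fun i => by
        by_cases hi : i ∈ S
        · simp [hi, S.min'_mem]
        · have : p i ∉ S := fun hp => h.2 _ hp (p.idem i)
          simp [hi, this] }
  else p

theorem split_apply {p : MinMap n} {S : Finset (Fin n)} (h : S.Nonempty)
    (h' : ∀ i ∈ S, p i ≠ i) (i : Fin n) :
    p.split S i = if i ∈ S then S.min' h else p i := by
  rw [split, dif_pos ⟨h, h'⟩]

/-- The pairs `(a, b)` with `a < b` of least elements of blocks, such that no block with at least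
two elements has a least element below `a`. -/
def admissible (p : MinMap n) : Finset (Fin n × Fin n) :=
  univ.filter fun e => p e.1 = e.1 ∧ p e.2 = e.2 ∧ e.1 < e.2 ∧ ∀ i, p i ≠ i → e.1 ≤ p i

theorem mem_admissible {p : MinMap n} {a b : Fin n} :
    (a, b) ∈ p.admissible ↔ p a = a ∧ p b = b ∧ a < b ∧ ∀ i, p i ≠ i → a ≤ p i := by
  simp [admissible]

theorem roots_merge {p : MinMap n} {a b : Fin n} (ha : p a = a) (hab : a < b) :
    (p.merge a b).roots = p.roots.erase b := by
  ext i
  rw [mem_roots, merge_apply ha hab, mem_erase, mem_roots]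
  split_ifs with h
  · constructor
    · rintro rfl
      exact ⟨hab.ne, ha⟩
    · rintro ⟨h1, h2⟩
      exact absurd (h2.symm.trans h) h1
  · constructor
    · intro h2
      exact ⟨fun h3 => h (h2.trans h3), h2⟩
    · exact fun h2 => h2.2

theorem card_roots_merge_lt {p : MinMap n} {a b : Fin n} (h : (a, b) ∈ p.admissible) :
    (p.merge a b).roots.card < p.roots.card := by
  obtain ⟨ha, hb, hab, -⟩ := mem_admissible.1 h
  rw [roots_merge ha hab]
  exact card_erase_lt_of_mem (mem_roots.2 hb)

theorem merge_ne_discrete {p : MinMap n} {a b : Fin n} (h : (a, b) ∈ p.admissible) :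
    p.merge a b ≠ discrete n := by
  obtain ⟨ha, hb, hab, -⟩ := mem_admissible.1 h
  intro h'
  have := congrArg (fun q : MinMap n => q b) h'
  simp only [merge_apply ha hab, hb, if_true, discrete_apply] at this
  exact hab.ne this

theorem exists_least_nontrivial {p : MinMap n} (hp : p ≠ discrete n) :
    ∃ a, (∃ i, p i = a ∧ i ≠ a) ∧ ∀ i, p i ≠ i → a ≤ p i := by
  have hne : (univ.filter fun i => p i ≠ i).Nonempty := by
    by_contra h
    rw [not_nonempty_iff_eq_empty] at h
    refine hp (ext_apply fun i => ?_)
    by_contra hi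
    have : i ∈ univ.filter fun i => p i ≠ i := by simpa using hi
    rw [h] at this
    simp at this
  obtain ⟨i, hi, hmin⟩ := exists_min_image _ p hne
  exact ⟨p i, ⟨i, rfl, Ne.symm (by simpa using hi)⟩, fun j hj => hmin j (by simpa using hj)⟩

/-- Detaching `S` changes only two fibers: the one over `a` loses `S`, and the one over the least
element of `S`, empty before, becomes `S`. -/
theorem weight_split {p : MinMap n} {a : Fin n} {S : Finset (Fin n)}
    (hS : S ⊆ (p.fiber a).erase a) (hne : S.Nonempty) :
    (p.split S).weight = (2 * S.card - 3)‼ * (2 * ((p.fiber a).card - S.card) - 3)‼ *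
      ∏ r ∈ univ.erase a, (2 * (p.fiber r).card - 3)‼ := by
  have hmem : ∀ i ∈ S, i ≠ a ∧ p i = a := fun i hi => by simpa using hS hi
  have hnr : ∀ i ∈ S, p i ≠ i := fun i hi h => (hmem i hi).1 (h.symm.trans (hmem i hi).2)
  set b := S.min' hne with hb
  have hbS : b ∈ S := S.min'_mem hne
  have hba : b ≠ a := (hmem b hbS).1
  have happ := split_apply hne hnr
  have hnb : ∀ i, p i ≠ b := fun i h => hnr b hbS (by rw [← h, p.idem])
  have f1 : (p.split S).fiber b = S := by
    ext i
    rw [mem_fiber, happ]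
    split_ifs with h
    · simp [h, hb]
    · simp [h, hnb i]
  have f2 : (p.split S).fiber a = p.fiber a \ S := by
    ext i
    rw [mem_fiber, happ, mem_sdiff, mem_fiber]
    split_ifs with h
    · simp [h, ← hb, hba]
    · simp [h]
  have f3 : ∀ r, r ≠ a → r ≠ b → (p.split S).fiber r = p.fiber r := by
    intro r hra hrb
    ext i
    rw [mem_fiber, happ, mem_fiber]
    split_ifs with h
    · rw [← hb, (hmem i h).2]
      exact ⟨fun h => absurd h.symm hrb, fun h => absurd h.symm hra⟩
    · rfl
  have f4 : (p.fiber b).card = 0 := by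
    rw [card_eq_zero, eq_empty_iff_forall_notMem]
    intro i
    simpa using hnb i
  have hbe : b ∈ (univ : Finset (Fin n)).erase a := by simp [hba]
  rw [weight, ← mul_prod_erase univ _ (mem_univ a), ← mul_prod_erase _ _ hbe,
    ← mul_prod_erase (univ.erase a) _ hbe, f1, f2, f4,
    card_sdiff_of_subset (hS.trans (erase_subset _ _))]
  have : ∏ x ∈ (univ.erase a).erase b, (2 * ((p.split S).fiber x).card - 3)‼ =
      ∏ x ∈ (univ.erase a).erase b, (2 * (p.fiber x).card - 3)‼ := by
    refine prod_congr rfl fun r hr => ?_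
    simp only [mem_erase, mem_univ, and_true] at hr
    rw [f3 r hr.2 hr.1]
  rw [this]
  simp
  ring

theorem sum_nonempty_subset_doubleFactorial {α : Type*} [DecidableEq α] {G : Finset α}
    (hG : G.Nonempty) :
    ∑ S ∈ G.powerset.filter (·.Nonempty),
      (2 * S.card - 3)‼ * (2 * (G.card + 1 - S.card) - 3)‼ = (2 * (G.card + 1) - 3)‼ := by
  have h1 := sum_powerset_apply_card (x := G)
    (fun j => (2 * j - 3)‼ * (2 * (G.card + 1 - j) - 3)‼)
  have h2 : G.powerset.filter (·.Nonempty) = G.powerset.erase ∅ := by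
    ext S
    simp [nonempty_iff_ne_empty, and_comm]
  obtain ⟨k, hk⟩ : ∃ k, G.card = k + 1 := ⟨G.card - 1, by have := hG.card_pos; omega⟩
  rw [h2]
  have h3 := add_sum_erase G.powerset
    (fun S => (2 * S.card - 3)‼ * (2 * (G.card + 1 - S.card) - 3)‼) (empty_mem_powerset G)
  rw [h1, sum_range_succ', hk] at h3
  have h4 := sum_choose_mul_doubleFactorial k
  rw [hk]
  simp only [smul_eq_mul, Nat.add_sub_add_right] at h3
  simp only [card_empty, Nat.choose_zero_right, one_mul] at h3
  rw [h4, add_comm] at h3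
  exact Nat.add_right_cancel h3

/-- The recurrence for the last merge. Its `a` is forced, so a last merge amounts to a nonempty
subset of the block of `a` that avoids `a`; the weights then add up by
`sum_nonempty_subset_doubleFactorial`, the other blocks being untouched. -/
theorem weight_eq_sum_admissible {p' : MinMap n} (hp : p' ≠ discrete n) :
    p'.weight = ∑ e : MinMap n × (Fin n × Fin n) with
      e.2 ∈ e.1.admissible ∧ e.1.merge e.2.1 e.2.2 = p', e.1.weight := by
  obtain ⟨a, ⟨i₀, hi₀, hia⟩, hmin⟩ := exists_least_nontrivial hp
  have ha : p' a = a := by rw [← hi₀, p'.idem]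
  set G := (p'.fiber a).erase a with hG
  have hGne : G.Nonempty := ⟨i₀, by simp [hG, hi₀, hia]⟩
  have hcard : G.card + 1 = (p'.fiber a).card := card_erase_add_one (by simpa using ha)
  have hW : p'.weight = ∑ S ∈ G.powerset.filter (·.Nonempty), (p'.split S).weight := by
    rw [weight, ← mul_prod_erase univ _ (mem_univ a), ← hcard,
      ← sum_nonempty_subset_doubleFactorial hGne, sum_mul]
    refine sum_congr rfl fun S hS => ?_
    rw [mem_filter, mem_powerset] at hS
    rw [weight_split hS.1 hS.2, hcard]
  rw [hW]
  have hmem : ∀ S ∈ G.powerset.filter (·.Nonempty), (∀ i ∈ S, i ≠ a ∧ p' i = a) ∧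
      (∀ i ∈ S, p' i ≠ i) := by
    intro S hS
    have h : ∀ i ∈ S, i ≠ a ∧ p' i = a := fun i hi => by
      simpa [hG] using (mem_powerset.1 (mem_filter.1 hS).1) hi
    exact ⟨h, fun i hi h' => (h i hi).1 (h'.symm.trans (h i hi).2)⟩
  -- Splitting off `S` and merging again are inverse; `S` is recovered as the fiber over `b` before
  -- the merge.
  refine sum_bij' (fun S hS => (p'.split S, (a, S.min' (mem_filter.1 hS).2)))
    (fun e _ => e.1.fiber e.2.2) ?_ ?_ ?_ ?_ ?_
  · intro S hS
    have hne := (mem_filter.1 hS).2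
    obtain ⟨h1, h2⟩ := hmem S hS
    have happ := split_apply hne h2
    have hb := S.min'_mem hne
    have haS : a ∉ S := fun h => (h1 a h).1 rfl
    have hab : a < S.min' hne := by
      have := p'.map_le (S.min' hne)
      rw [(h1 _ hb).2] at this
      exact lt_of_le_of_ne this (h1 _ hb).1.symm
    have hsa : p'.split S a = a := by rw [happ, if_neg haS, ha]
    rw [mem_filter]
    refine ⟨mem_univ _, mem_admissible.2 ⟨hsa, by rw [happ, if_pos hb], hab, ?_⟩, ?_⟩
    · intro i hi
      rw [happ] at hi ⊢
      split_ifs at hi ⊢ with h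
      · exact hab.le
      · exact hmin i hi
    · refine ext_apply fun i => ?_
      rw [merge_apply hsa hab, happ]
      by_cases h : i ∈ S
      · simp [h, (h1 i h).2]
      · rw [if_neg h, if_neg]
        intro h3
        exact h2 _ hb (by rw [← h3, p'.idem])
  · rintro ⟨p, a', b⟩ he
    obtain ⟨h1, rfl⟩ := (mem_filter.1 he).2
    obtain ⟨ha', hb, hab, hmin'⟩ := mem_admissible.1 h1
    dsimp only at ha' hb hab hmin' hmin ⊢
    have happ := merge_apply ha' hab
    -- The merged block is nonsingleton, so `a ≤ a'`. Conversely, the block of `a` either is the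
    -- merged block or was nonsingleton already before, where admissibility gives `a' ≤ a`.
    have haa : a' = a := by
      apply le_antisymm
      · rw [happ] at hi₀
        split_ifs at hi₀ with h
        · exact hi₀.le
        · rw [← hi₀]
          exact hmin' i₀ (by rw [hi₀]; exact hia.symm)
      · have := hmin b (by rw [happ, if_pos hb]; exact hab.ne)
        rwa [happ, if_pos hb] at this
    subst haa
    rw [mem_filter, mem_powerset]
    refine ⟨fun i hi => ?_, ⟨b, by simpa using hb⟩⟩
    rw [mem_fiber] at hi
    rw [hG, mem_erase, mem_fiber, happ, if_pos hi]
    refine ⟨?_, rfl⟩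
    rintro rfl
    exact hab.ne (ha'.symm.trans hi)
  · intro S hS
    have hne := (mem_filter.1 hS).2
    obtain ⟨h1, h2⟩ := hmem S hS
    have happ := split_apply hne h2
    ext i
    rw [mem_fiber, happ]
    split_ifs with h
    · simp [h]
    · simp only [h, iff_false]
      intro h3
      exact h2 _ (S.min'_mem hne) (by rw [← h3, p'.idem])
  · rintro ⟨p, a', b⟩ he
    obtain ⟨h1, rfl⟩ := (mem_filter.1 he).2
    obtain ⟨ha', hb, hab, hmin'⟩ := mem_admissible.1 h1
    dsimp only at ha' hb hab hmin' hmin ⊢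
    have happ := merge_apply ha' hab
    have haa : a' = a := by
      apply le_antisymm
      · rw [happ] at hi₀
        split_ifs at hi₀ with h
        · exact hi₀.le
        · rw [← hi₀]
          exact hmin' i₀ (by rw [hi₀]; exact hia.symm)
      · have := hmin b (by rw [happ, if_pos hb]; exact hab.ne)
        rwa [happ, if_pos hb] at this
    have hbm : b ∈ p.fiber b := by simpa using hb
    have hmn : ∀ h, (p.fiber b).min' h = b := fun h =>
      le_antisymm (min'_le _ _ hbm) (le_min' _ _ _ fun i hi => by
        rw [mem_fiber] at hi
        rw [← hi]
        exact p.map_le i)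
    have hs : (p.merge a' b).split (p.fiber b) = p := by
      refine ext_apply fun i => ?_
      rw [split_apply (show (p.fiber b).Nonempty from ⟨b, hbm⟩), hmn]
      · by_cases h : p i = b
        · simp [h]
        · simp [h, happ]
      · intro i hi
        rw [mem_fiber] at hi
        rw [happ, if_pos hi]
        rintro rfl
        exact hab.ne (ha'.symm.trans hi)
    rw [hs, hmn, haa]
  · intro S hS
    rfl

/-- The sum of `w` over the ends of all sequences of admissible merges that start at `p`. -/
noncomputable def mergeSum (w : MinMap n → ℕ) (p : MinMap n) : ℕ :=
  w p + ∑ e ∈ p.admissible.attach, mergeSum w (p.merge e.1.1 e.1.2)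
termination_by p.roots.card
decreasing_by exact card_roots_merge_lt e.2

theorem mergeSum_eq (w : MinMap n → ℕ) (p : MinMap n) :
    mergeSum w p = w p + ∑ e ∈ p.admissible, mergeSum w (p.merge e.1 e.2) := by
  rw [mergeSum, sum_attach p.admissible fun e => mergeSum w (p.merge e.1 e.2)]

theorem weight_discrete : (discrete n).weight = 1 := by
  refine prod_eq_one fun r _ => ?_
  have : (discrete n).fiber r = {r} := by
    ext i
    simp
  simp [this]

/-- In effect `weight p` counts the admissible sequences from the singletons to `p`. Summing `weight
p * mergeSum w p` over all `p` and unfolding `mergeSum` once, the recurrence for `weight` reproduces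
every term except that of the discrete partition; the rest cancels. -/
theorem mergeSum_discrete (w : MinMap n → ℕ) :
    mergeSum w (discrete n) = ∑ p : MinMap n, w p * p.weight := by
  have h1 : ∑ p : MinMap n, p.weight * mergeSum w p =
      ∑ p : MinMap n, w p * p.weight + ∑ p : MinMap n, ∑ e ∈ p.admissible,
        p.weight * mergeSum w (p.merge e.1 e.2) := by
    rw [← sum_add_distrib]
    refine sum_congr rfl fun p _ => ?_
    rw [mergeSum_eq, mul_add, mul_sum, mul_comm]
  have h2 : ∑ p : MinMap n, ∑ e ∈ p.admissible, p.weight * mergeSum w (p.merge e.1 e.2) =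
      ∑ p ∈ univ.erase (discrete n), p.weight * mergeSum w p := by
    have h3 : ∑ p : MinMap n, ∑ e ∈ p.admissible, p.weight * mergeSum w (p.merge e.1 e.2) =
        ∑ e : MinMap n × (Fin n × Fin n) with e.2 ∈ e.1.admissible,
          e.1.weight * mergeSum w (e.1.merge e.2.1 e.2.2) := by
      rw [sum_filter, Fintype.sum_prod_type]
      refine sum_congr rfl fun p _ => ?_
      rw [← sum_filter]
      refine sum_congr ?_ fun _ _ => rfl
      ext
      simp
    rw [h3, ← sum_fiberwise_of_maps_to (t := univ.erase (discrete n))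
      (g := fun e : MinMap n × (Fin n × Fin n) => e.1.merge e.2.1 e.2.2)]
    · refine sum_congr rfl fun p' hp' => ?_
      rw [weight_eq_sum_admissible (mem_erase.1 hp').1, sum_mul, filter_filter]
      refine sum_congr rfl fun e he => ?_
      rw [(mem_filter.1 he).2.2]
    · intro e he
      exact mem_erase.2 ⟨merge_ne_discrete (mem_filter.1 he).2, mem_univ _⟩
  rw [h2, ← add_sum_erase univ _ (mem_univ (discrete n)), weight_discrete, one_mul] at h1
  exact Nat.add_right_cancel h1

/-! ### Passage to partitions given by their blocks. -/

theorem fiber_injOn (p : MinMap n) : Set.InjOn p.fiber p.roots := by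
  intro r hr r' _ h
  have hr : p r = r := by simpa using hr
  have : r ∈ p.fiber r' := by rw [← h, mem_fiber, hr]
  rw [mem_fiber] at this
  exact hr.symm.trans this

/-- The partition of `Fin n` into the nonempty fibers. -/
def toFinpartition (p : MinMap n) : Finpartition (univ : Finset (Fin n)) :=
  Finpartition.ofExistsUnique (p.roots.image p.fiber) (fun _ _ => subset_univ _)
    (fun i _ => by
      refine ⟨p.fiber (p i), ⟨mem_image_of_mem _ (by simp), by simp⟩, ?_⟩
      rintro t ⟨ht, hi⟩
      obtain ⟨r, -, rfl⟩ := mem_image.1 ht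
      rw [(mem_fiber.1 hi)])
    (fun h => by
      obtain ⟨r, hr, h⟩ := mem_image.1 h
      have : r ∈ p.fiber r := by simpa using hr
      rw [h] at this
      simp at this)

@[simp] theorem toFinpartition_parts (p : MinMap n) :
    p.toFinpartition.parts = p.roots.image p.fiber := rfl

theorem toFinpartition_bijective :
    Function.Bijective (toFinpartition : MinMap n → Finpartition (univ : Finset (Fin n))) := by
  constructor
  · have key : ∀ p q : MinMap n, p.toFinpartition = q.toFinpartition → ∀ i, q i ≤ p i := by
      intro p q h i
      have h1 : p.fiber (p i) ∈ q.toFinpartition.parts := by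
        rw [← h]
        exact mem_image_of_mem _ (by simp)
      obtain ⟨r, -, hr⟩ := mem_image.1 h1
      have h2 : i ∈ q.fiber r := by rw [hr]; simp
      have h3 : p i ∈ q.fiber r := by rw [hr]; simp
      rw [mem_fiber] at h2 h3
      rw [h2, ← h3]
      exact q.map_le _
    intro p q h
    exact ext_apply fun i => le_antisymm (key q p h.symm i) (key p q h i)
  · intro π
    have hne : ∀ i, (π.part i).Nonempty := fun i => ⟨i, π.mem_part (mem_univ i)⟩
    have hpart : ∀ i, π.part ((π.part i).min' (hne i)) = π.part i := fun i =>
      π.part_eq_of_mem (π.part_mem.2 (mem_univ i)) (min'_mem _ _)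
    let p : MinMap n :=
      { toFun := fun i => (π.part i).min' (hne i)
        map_le' := fun i => min'_le _ _ (π.mem_part (mem_univ i))
        idem' := fun i => by simp only [hpart] }
    have hp : ∀ i, p i = (π.part i).min' (hne i) := fun _ => rfl
    have hfib : ∀ i, p.fiber (p i) = π.part i := by
      intro i
      ext j
      rw [mem_fiber]
      constructor
      · intro h
        have h2 := hpart i
        rw [← hp, ← h, hp, hpart] at h2
        rw [← h2]
        exact π.mem_part (mem_univ j)
      · intro h
        have : π.part j = π.part i := π.part_eq_of_mem (π.part_mem.2 (mem_univ i)) h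
        simp only [hp, this]
    refine ⟨p, Finpartition.ext ?_⟩
    ext B
    rw [toFinpartition_parts, mem_image]
    constructor
    · rintro ⟨r, hr, rfl⟩
      rw [mem_roots] at hr
      rw [← hr, hfib]
      exact π.part_mem.2 (mem_univ r)
    · intro hB
      obtain ⟨i, hi⟩ := π.nonempty_of_mem_parts hB
      exact ⟨p i, by simp, by rw [hfib, π.part_eq_of_mem hB hi]⟩

theorem prod_toFinpartition (p : MinMap n) :
    ∏ B ∈ p.toFinpartition.parts, (2 * B.card - 3)‼ = p.weight := by
  rw [toFinpartition_parts, prod_image p.fiber_injOn, weight]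
  refine prod_subset (subset_univ _) fun r _ hr => ?_
  have : p.fiber r = ∅ := by
    rw [eq_empty_iff_forall_notMem]
    intro i hi
    rw [mem_fiber] at hi
    exact hr (by rw [mem_roots, ← hi, p.idem])
  simp [this]

theorem partitionSum_eq (f : Finpartition (univ : Finset (Fin n)) → ℕ) :
    partitionSum n f = mergeSum (fun p => f p.toFinpartition) (discrete n) := by
  rw [mergeSum_discrete, partitionSum]
  symm
  refine Fintype.sum_bijective _ toFinpartition_bijective _ _ fun p => ?_
  rw [prod_toFinpartition]

theorem card_parts_toFinpartition (p : MinMap n) :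
    p.toFinpartition.parts.card = p.roots.card :=
  card_image_of_injOn p.fiber_injOn

theorem numNonsingleton_toFinpartition (p : MinMap n) :
    numNonsingleton p.toFinpartition =
      (p.roots.filter fun r => (p.fiber r).card ≠ 1).card := by
  rw [numNonsingleton, toFinpartition_parts, filter_image]
  exact card_image_of_injOn (p.fiber_injOn.mono (coe_subset.2 (filter_subset _ _)))

end MinMap

/-! ### Signed partitions with at most one signed block, as maps to representatives. -/

/-- The involution `i ↔ ī`. -/
def bar {n : ℕ} (u : DoubleSet n) : DoubleSet n := (u.1, !u.2)

section bar

variable {n : ℕ}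

@[simp] theorem bar_bar (u : DoubleSet n) : bar (bar u) = u := by simp [bar]

@[simp] theorem bar_fst (u : DoubleSet n) : (bar u).1 = u.1 := rfl

theorem bar_ne (u : DoubleSet n) : bar u ≠ u := fun h => by
  simpa [bar] using congrArg Prod.snd h

theorem eq_or_eq_bar_of_fst_eq {u v : DoubleSet n} (h : u.1 = v.1) : u = v ∨ u = bar v := by
  obtain ⟨i, a⟩ := u
  obtain ⟨j, b⟩ := v
  obtain rfl : i = j := h
  cases a <;> cases b <;> simp [bar]

@[simp] theorem mem_barSet {X : Finset (DoubleSet n)} {u : DoubleSet n} :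
    u ∈ barSet X ↔ bar u ∈ X := by
  rw [barSet, mem_image]
  constructor
  · rintro ⟨v, hv, rfl⟩
    change bar (bar v) ∈ X
    rwa [bar_bar]
  · exact fun h => ⟨bar u, h, bar_bar u⟩

end bar

/-- A signed partition with at most one signed block, given by the map that sends each element to
the canonical representative of its block, and the elements of the signed block to `none`. -/
@[ext]
structure RepMap (n : ℕ) where
  toFun : DoubleSet n → Option (DoubleSet n)
  map_bar' : ∀ u, toFun (bar u) = (toFun u).map bar
  le' : ∀ u v, toFun u = some v → v.1 ≤ u.1
  idem' : ∀ u v, toFun u = some v → toFun v = some v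

namespace RepMap

variable {n : ℕ}

instance : CoeFun (RepMap n) fun _ => DoubleSet n → Option (DoubleSet n) := ⟨toFun⟩

theorem map_bar (E : RepMap n) (u : DoubleSet n) : E (bar u) = (E u).map bar := E.map_bar' u

theorem fst_le (E : RepMap n) {u v : DoubleSet n} (h : E u = some v) : v.1 ≤ u.1 := E.le' u v h

theorem idem (E : RepMap n) {u v : DoubleSet n} (h : E u = some v) : E v = some v := E.idem' u v h

theorem ext_apply {E F : RepMap n} (h : ∀ u, E u = F u) : E = F := RepMap.ext (funext h)

theorem apply_bar_eq_none {E : RepMap n} {u : DoubleSet n} : E (bar u) = none ↔ E u = none := by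
  rw [E.map_bar, Option.map_eq_none_iff]

theorem apply_eq_apply_bar {E : RepMap n} {u : DoubleSet n} : E u = E (bar u) ↔ E u = none := by
  rw [E.map_bar]
  cases h : E u with
  | none => simp
  | some v => simpa using (bar_ne v).symm

instance : Finite (RepMap n) :=
  Finite.of_injective (fun E => E.toFun) fun _ _ h => RepMap.ext h

/-- The least elements of the unsigned blocks. -/
def roots (E : RepMap n) : Finset (Fin n) := univ.filter fun r => E (r, false) = some (r, false)

theorem mem_roots {E : RepMap n} {r : Fin n} :
    r ∈ E.roots ↔ E (r, false) = some (r, false) := by simp [roots]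

theorem fst_mem_roots {E : RepMap n} {w : DoubleSet n} : w.1 ∈ E.roots ↔ E w = some w := by
  obtain ⟨r, b⟩ := w
  rw [mem_roots]
  cases b with
  | false => rfl
  | true =>
    have h := E.map_bar (r, false)
    have h' := E.map_bar (r, true)
    constructor
    · intro h1
      rw [h1] at h
      exact h
    · intro h1
      rw [h1] at h'
      exact h'

theorem mem_roots_of_apply {E : RepMap n} {u v : DoubleSet n} (h : E u = some v) :
    v.1 ∈ E.roots := fst_mem_roots.2 (E.idem h)

/-- The signed block. -/
def zero (E : RepMap n) : Finset (DoubleSet n) := univ.filter fun u => E u = none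

@[simp] theorem mem_zero {E : RepMap n} {u : DoubleSet n} : u ∈ E.zero ↔ E u = none := by
  simp [zero]

/-- Refinement means that the representative map of the coarser partition factors through that of
the finer one. -/
instance : PartialOrder (RepMap n) where
  le E F := ∀ u, F u = (E u).bind F
  le_refl E u := by
    cases h : E u with
    | none => rfl
    | some v => exact (E.idem h).symm
  le_trans E F G h1 h2 u := by
    rw [h2 u, h1 u]
    cases E u with
    | none => rfl
    | some v => exact (h2 v).symm
  le_antisymm E F h1 h2 := by
    refine ext_apply fun u => ?_
    cases h : E u with
    | none => rw [h1 u, h]; rfl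
    | some v =>
      have h3 : F u = F v := by rw [h1 u, h]; rfl
      rw [h3]
      have h4 := h2 v
      rw [E.idem h] at h4
      cases h5 : F v with
      | none => rw [h5] at h4; exact h4
      | some w =>
        rw [h5] at h4
        have h6 : v.1 = w.1 := le_antisymm (E.fst_le h4.symm) (F.fst_le h5)
        rcases eq_or_eq_bar_of_fst_eq h6 with h7 | h7
        · rw [h7]
        -- Otherwise `w` and `bar w` would have the same representative under `F`, which makes their
        -- block signed.
        · exfalso
          have h8 := F.idem h5
          rw [h7, F.map_bar, h8, Option.map_some, Option.some.injEq] at h5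
          exact bar_ne w h5

theorem le_def {E F : RepMap n} : E ≤ F ↔ ∀ u, F u = (E u).bind F := Iff.rfl

theorem apply_eq_none_of_le {E F : RepMap n} (h : E ≤ F) {u : DoubleSet n} (hu : E u = none) :
    F u = none := by
  rw [h u, hu]
  rfl

theorem apply_eq_of_le {E F : RepMap n} (h : E ≤ F) {u v : DoubleSet n} (hu : E u = some v) :
    F u = F v := by
  rw [h u, hu]
  rfl

theorem zero_subset_of_le {E F : RepMap n} (h : E ≤ F) : E.zero ⊆ F.zero := fun _ hu =>
  mem_zero.2 (apply_eq_none_of_le h (mem_zero.1 hu))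

theorem roots_subset_of_le {E F : RepMap n} (h : E ≤ F) : F.roots ⊆ E.roots := by
  intro r hr
  rw [mem_roots] at hr
  cases h1 : E (r, false) with
  | none => rw [apply_eq_none_of_le h h1] at hr; simp at hr
  | some v =>
    rw [apply_eq_of_le h h1] at hr
    have h2 : v.1 = r := le_antisymm (E.fst_le h1) (F.fst_le hr)
    rw [← h2]
    exact mem_roots_of_apply h1

/-- If every root of `E` stayed a root of `F`, then `F` would fix all representatives of `E` and so
equal `E`. Thus the number of roots is strictly decreasing, and a lost root shows which elementary
move lies below `F`. -/
theorem exists_root_of_lt {E F : RepMap n} (h : E < F) : ∃ r ∈ E.roots, r ∉ F.roots := by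
  by_contra! h1
  refine h.ne (ext_apply fun u => ?_)
  cases h2 : E u with
  | none => exact (apply_eq_none_of_le h.le h2).symm
  | some v =>
    rw [apply_eq_of_le h.le h2]
    exact (fst_mem_roots.1 (h1 _ (mem_roots_of_apply h2))).symm

theorem card_roots_lt_of_lt {E F : RepMap n} (h : E < F) : F.roots.card < E.roots.card := by
  obtain ⟨r, hr, hr'⟩ := exists_root_of_lt h
  exact card_lt_card ((ssubset_iff_of_subset (roots_subset_of_le h.le)).2 ⟨r, hr, hr'⟩)

/-- Join the block of `(b, false)` with the block of `w`, and the bars of these blocks, if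
`w.1 < b` are least elements of unsigned blocks. -/
def join (E : RepMap n) (w : DoubleSet n) (b : Fin n) : RepMap n :=
  if h : E w = some w ∧ w.1 < b then
    { toFun := fun u => (E u).map fun v => if v.1 = b then (if v.2 then bar w else w) else v
      map_bar' := fun u => by
        rw [E.map_bar]
        cases E u with
        | none => rfl
        | some v =>
          obtain ⟨i, c⟩ := v
          by_cases h1 : i = b <;> cases c <;> simp [h1, bar]
      le' := fun u v hv => by
        rw [Option.map_eq_some_iff] at hv
        obtain ⟨v, hv, rfl⟩ := hv
        have hle := E.fst_le hv
        split_ifs with h1 h2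
        · exact h.2.le.trans (h1 ▸ hle)
        · exact h.2.le.trans (h1 ▸ hle)
        · exact hle
      idem' := fun u v hv => by
        rw [Option.map_eq_some_iff] at hv
        obtain ⟨v, hv, rfl⟩ := hv
        have hv' := E.idem hv
        split_ifs with h1 h2
        · rw [E.map_bar, h.1]
          simp [h.2.ne]
        · rw [h.1]
          simp [h.2.ne]
        · rw [hv']
          simp [h1] }
  else E

theorem join_apply {E : RepMap n} {w : DoubleSet n} {b : Fin n} (hw : w.1 ∈ E.roots)
    (h : w.1 < b) (u : DoubleSet n) :
    E.join w b u =
      (E u).map fun v => if v.1 = b then (if v.2 then bar w else w) else v := by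
  rw [join, dif_pos ⟨fst_mem_roots.1 hw, h⟩]

/-- Add the block of `(a, false)` and its bar to the signed block. -/
def sign (E : RepMap n) (a : Fin n) : RepMap n where
  toFun u := (E u).bind fun v => if v.1 = a then none else some v
  map_bar' u := by
    rw [E.map_bar]
    cases E u with
    | none => rfl
    | some v =>
      by_cases h1 : v.1 = a <;> simp [h1]
  le' u v hv := by
    rw [Option.bind_eq_some_iff] at hv
    obtain ⟨v', hv, h⟩ := hv
    split_ifs at h
    obtain rfl : v' = v := by simpa using h
    exact E.fst_le hv
  idem' u v hv := by
    rw [Option.bind_eq_some_iff] at hv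
    obtain ⟨v', hv, h⟩ := hv
    split_ifs at h with h1
    obtain rfl : v' = v := by simpa using h
    rw [E.idem hv]
    simp [h1]

theorem sign_apply (E : RepMap n) (a : Fin n) (u : DoubleSet n) :
    E.sign a u = (E u).bind fun v => if v.1 = a then none else some v := rfl

theorem sign_apply_eq_none {E : RepMap n} {a : Fin n} {u : DoubleSet n} :
    E.sign a u = none ↔ E u = none ∨ ∃ v, E u = some v ∧ v.1 = a := by
  rw [sign_apply]
  cases E u <;> simp

theorem zero_join {E : RepMap n} {w : DoubleSet n} {b : Fin n} (hw : w.1 ∈ E.roots)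
    (h : w.1 < b) : (E.join w b).zero = E.zero := by
  ext u
  rw [mem_zero, mem_zero, join_apply hw h, Option.map_eq_none_iff]

theorem le_join {E : RepMap n} {w : DoubleSet n} {b : Fin n} (hw : w.1 ∈ E.roots)
    (h : w.1 < b) : E ≤ E.join w b := by
  intro u
  rw [join_apply hw h]
  cases h1 : E u with
  | none => rfl
  | some v =>
    rw [Option.bind_some, join_apply hw h, E.idem h1]

theorem le_sign (E : RepMap n) (a : Fin n) : E ≤ E.sign a := by
  intro u
  rw [sign_apply]
  cases h1 : E u with
  | none => rfl
  | some v => rw [Option.bind_some, Option.bind_some, sign_apply, E.idem h1, Option.bind_some]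

theorem roots_join {E : RepMap n} {w : DoubleSet n} {b : Fin n} (hw : w.1 ∈ E.roots)
    (h : w.1 < b) : (E.join w b).roots = E.roots.erase b := by
  ext r
  rw [mem_erase]
  constructor
  · intro hr
    refine ⟨?_, roots_subset_of_le (le_join hw h) hr⟩
    rintro rfl
    have h1 := roots_subset_of_le (le_join hw h) hr
    rw [mem_roots] at hr h1
    rw [join_apply hw h, h1] at hr
    have h2 : w = (r, false) := by simpa using hr
    exact h.ne (by rw [h2])
  · rintro ⟨h1, h2⟩
    rw [mem_roots] at h2 ⊢
    rw [join_apply hw h, h2]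
    simp [h1]

theorem roots_sign (E : RepMap n) (a : Fin n) : (E.sign a).roots = E.roots.erase a := by
  ext r
  rw [mem_erase]
  constructor
  · intro hr
    have h1 := roots_subset_of_le (le_sign E a) hr
    refine ⟨?_, h1⟩
    rintro rfl
    rw [mem_roots] at hr h1
    rw [sign_apply, h1] at hr
    simp at hr
  · rintro ⟨h1, h2⟩
    rw [mem_roots] at h2 ⊢
    rw [sign_apply, h2]
    simp [h1]

theorem lt_join {E : RepMap n} {w : DoubleSet n} {b : Fin n} (hw : w.1 ∈ E.roots)
    (hb : b ∈ E.roots) (h : w.1 < b) : E < E.join w b := by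
  refine lt_of_le_of_ne (le_join hw h) fun h1 => ?_
  have h2 := roots_join hw h
  rw [← h1] at h2
  rw [h2] at hb
  simp at hb

theorem lt_sign {E : RepMap n} {a : Fin n} (ha : a ∈ E.roots) : E < E.sign a := by
  refine lt_of_le_of_ne (le_sign E a) fun h1 => ?_
  have h2 := roots_sign E a
  rw [← h1] at h2
  rw [h2] at ha
  simp at ha

theorem zero_ssubset_zero_sign {E : RepMap n} {a : Fin n} (ha : a ∈ E.roots) :
    E.zero ⊂ (E.sign a).zero := by
  rw [ssubset_iff_of_subset (zero_subset_of_le (le_sign E a))]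
  refine ⟨(a, false), ?_, ?_⟩
  · rw [mem_zero, sign_apply_eq_none]
    exact Or.inr ⟨_, mem_roots.1 ha, rfl⟩
  · rw [mem_zero, mem_roots.1 ha]
    simp

/-- Together with `join_le`, this inserts an elementary move between `E` and `F` at a root of `E`
that `F` loses; for a cover, the move must then be all of `F`. -/
theorem sign_le {E F : RepMap n} (h : E ≤ F) {r : Fin n} (hr : F (r, false) = none) :
    E.sign r ≤ F := by
  have hr' : F (r, true) = none := apply_bar_eq_none (u := (r, false)).2 hr
  intro u
  rw [sign_apply]
  cases h1 : E u with
  | none => exact apply_eq_none_of_le h h1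
  | some v =>
    rw [apply_eq_of_le h h1, Option.bind_some]
    split_ifs with h2
    · obtain ⟨i, b⟩ := v
      obtain rfl : i = r := h2
      cases b <;> assumption
    · rfl

theorem join_le {E F : RepMap n} (h : E ≤ F) {r : Fin n} {w : DoubleSet n}
    (hw : w.1 ∈ E.roots) (hwr : w.1 < r) (hr : F (r, false) = F w) :
    E.join w r ≤ F := by
  have hr' : F (r, true) = F (bar w) := by
    rw [F.map_bar, ← hr, ← F.map_bar]
    rfl
  intro u
  rw [join_apply hw hwr]
  cases h1 : E u with
  | none => exact apply_eq_none_of_le h h1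
  | some v =>
    rw [apply_eq_of_le h h1, Option.map_some, Option.bind_some]
    obtain ⟨i, b⟩ := v
    dsimp only
    split_ifs with h2 h3
    · subst h2
      rw [h3, hr']
    · subst h2
      rw [Bool.not_eq_true] at h3
      rw [h3, hr]
    · rfl

end RepMap

/-! ### Identification of labeled partitions with representative maps. -/

namespace LabeledPartition

variable {n : ℕ} {Sg : Type*}

theorem part_bar (x : LabeledPartition n Sg) (u : DoubleSet n) :
    x.part.part (bar u) = barSet (x.part.part u) :=
  x.part.part_eq_of_mem (x.barSet_mem _ (x.part.part_mem.2 (mem_univ u)))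
    (by simp)

theorem mem_part_comm (x : LabeledPartition n Sg) {u v : DoubleSet n} :
    v ∈ x.part.part u ↔ x.part.part v = x.part.part u :=
  ⟨fun h => x.part.part_eq_of_mem (x.part.part_mem.2 (mem_univ u)) h,
    fun h => h ▸ x.part.mem_part (mem_univ v)⟩

theorem bar_mem_part_iff (x : LabeledPartition n Sg) {u : DoubleSet n} :
    bar u ∈ x.part.part u ↔ ∃ σ, x.label (x.part.part u) = some σ := by
  rw [mem_part_comm, part_bar, ← x.barSet_eq_iff _ (x.part.part_mem.2 (mem_univ u)), eq_comm]

/-- The canonical representative of the block of `u`, if this block is unsigned. -/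
noncomputable def rep (x : LabeledPartition n Sg) (u : DoubleSet n) : Option (DoubleSet n) :=
  if bar u ∈ x.part.part u then none
  else some (exists_min_image (x.part.part u) Prod.fst
    ⟨u, x.part.mem_part (mem_univ u)⟩).choose

theorem rep_eq_none_iff {x : LabeledPartition n Sg} {u : DoubleSet n} :
    x.rep u = none ↔ bar u ∈ x.part.part u := by
  simp [rep]

theorem rep_eq_some_iff {x : LabeledPartition n Sg} {u v : DoubleSet n} :
    x.rep u = some v ↔ bar u ∉ x.part.part u ∧ v ∈ x.part.part u ∧
      ∀ w ∈ x.part.part u, v.1 ≤ w.1 := by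
  by_cases h : bar u ∈ x.part.part u
  · simp [rep, h]
  · have hex := exists_min_image (x.part.part u) Prod.fst ⟨u, x.part.mem_part (mem_univ u)⟩
    have hspec := hex.choose_spec
    have hr : x.rep u = some hex.choose := if_neg h
    rw [hr, Option.some.injEq]
    constructor
    · rintro rfl
      exact ⟨h, hspec⟩
    · rintro ⟨-, h1, h2⟩
      rcases eq_or_eq_bar_of_fst_eq (le_antisymm (hspec.2 v h1) (h2 _ hspec.1)) with h3 | h3
      · exact h3
      -- Two minimizers can differ only by a bar, and then the block would contain both and be its
      -- own bar.
      · exfalso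
        rw [h3] at hspec
        have h4 := (x.mem_part_comm).1 h1
        have h5 := hspec.1
        rw [← h4, bar_mem_part_iff, h4, ← bar_mem_part_iff] at h5
        exact h h5

/-- The map of canonical representatives. -/
noncomputable def repMap (x : LabeledPartition n Sg) : RepMap n where
  toFun := x.rep
  map_bar' u := by
    cases h : x.rep u with
    | none =>
      rw [rep_eq_none_iff] at h
      rw [Option.map_none, rep_eq_none_iff, part_bar, mem_barSet, bar_bar]
      exact h
    | some v =>
      rw [rep_eq_some_iff] at h
      obtain ⟨h1, h2, h3⟩ := h
      rw [Option.map_some, rep_eq_some_iff, part_bar, mem_barSet, mem_barSet, bar_bar, bar_bar]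
      exact ⟨h1, h2, fun w hw => h3 (bar w) (mem_barSet.1 hw)⟩
  le' u v h := (rep_eq_some_iff.1 h).2.2 u (x.part.mem_part (mem_univ u))
  idem' u v h := by
    have h' := h
    rw [rep_eq_some_iff] at h
    obtain ⟨h1, h2, h3⟩ := h
    have h4 := (x.mem_part_comm).1 h2
    rw [rep_eq_some_iff, h4]
    refine ⟨fun h5 => h1 ?_, h2, h3⟩
    rwa [← h4, bar_mem_part_iff, h4, ← bar_mem_part_iff] at h5

theorem repMap_eq_none_iff {x : LabeledPartition n Sg} {u : DoubleSet n} :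
    x.repMap u = none ↔ ∃ σ, x.label (x.part.part u) = some σ := by
  rw [← bar_mem_part_iff]
  exact rep_eq_none_iff

theorem repMap_eq_of_mem_part {x : LabeledPartition n Sg} {u v : DoubleSet n}
    (h : v ∈ x.part.part u) : x.repMap v = x.repMap u := by
  have h1 := (x.mem_part_comm).1 h
  have h2 : bar v ∈ x.part.part v ↔ bar u ∈ x.part.part u := by
    rw [bar_mem_part_iff, h1, ← bar_mem_part_iff]
  -- The chosen minimizer depends only on the block, so equal blocks give equal choices.
  change (if bar v ∈ x.part.part v then none else _) = (if bar u ∈ x.part.part u then none else _)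
  simp only [h2]
  simp only [h1]

/-- A single sign is essential: all signed blocks have the representative `none`, so there must be
at most one of them. -/
theorem mem_part_iff [Subsingleton Sg] {x : LabeledPartition n Sg} {u v : DoubleSet n} :
    v ∈ x.part.part u ↔ x.repMap v = x.repMap u := by
  refine ⟨repMap_eq_of_mem_part, fun h => ?_⟩
  rw [mem_part_comm]
  cases hu : x.repMap u with
  | none =>
    obtain ⟨σ, hσ⟩ := repMap_eq_none_iff.1 hu
    obtain ⟨τ, hτ⟩ := repMap_eq_none_iff.1 (h.trans hu)
    exact x.label_injective _ _ σ (by rw [hτ, Subsingleton.elim τ σ]) hσ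
  | some w =>
    have h1 := (rep_eq_some_iff.1 hu).2.1
    have h2 := (rep_eq_some_iff.1 (h.trans hu)).2.1
    rw [← (x.mem_part_comm).1 h1, ← (x.mem_part_comm).1 h2]

theorem le_iff [Subsingleton Sg] [DecidableEq Sg] {x y : LabeledPartition n Sg} :
    x ≤ y ↔ x.repMap ≤ y.repMap := by
  constructor
  · intro h
    have key : ∀ u v, x.repMap v = x.repMap u → y.repMap v = y.repMap u := by
      intro u v huv
      obtain ⟨T, hT, hsub⟩ := Refines.exists_part h (x.part.part_mem.2 (mem_univ u))
      have h1 := y.part.part_eq_of_mem hT (hsub (x.part.mem_part (mem_univ u)))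
      have h2 := hsub (mem_part_iff.2 huv)
      rw [← h1] at h2
      exact mem_part_iff.1 h2
    intro u
    cases hu : x.repMap u with
    | none =>
      have := key u (bar u) ((RepMap.apply_bar_eq_none.2 hu).trans hu.symm)
      rw [Option.bind_none]
      exact RepMap.apply_eq_apply_bar.1 this.symm
    | some v =>
      exact (key u v ((x.repMap.idem hu).trans hu.symm)).symm
  · intro h
    refine ⟨fun σ u hu => ?_, fun R hR => ?_⟩
    · rw [signedBlock, mem_filter] at hu ⊢
      have h1 := RepMap.apply_eq_none_of_le h (repMap_eq_none_iff.2 ⟨σ, hu.2⟩)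
      obtain ⟨τ, hτ⟩ := repMap_eq_none_iff.1 h1
      exact ⟨mem_univ _, by rw [hτ, Subsingleton.elim τ σ]⟩
    · obtain ⟨u, hu⟩ := x.part.nonempty_of_mem_parts hR.1
      refine ⟨y.part.part u, y.part.part_mem.2 (mem_univ u), fun v hv => ?_⟩
      rw [← x.part.part_eq_of_mem hR.1 hu, mem_part_iff] at hv
      rw [mem_part_iff, h v, h u, hv]

open Classical in
/-- The labeled partition with a given map of canonical representatives. -/
noncomputable def ofRepMap (σ : Sg) (E : RepMap n) : LabeledPartition n Sg where
  part := Finpartition.ofSetoid (Setoid.ker E.toFun)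
  label B := if B ∈ (Finpartition.ofSetoid (Setoid.ker E.toFun)).parts ∧ B = barSet B
    then some σ else none
  label_of_notMem B hB := if_neg fun h => hB h.1
  label_injective B B' τ h h' := by
    split_ifs at h h' with h1 h2
    set P := Finpartition.ofSetoid (Setoid.ker E.toFun)
    have key : ∀ B, B ∈ P.parts ∧ B = barSet B → ∃ u, P.part u = B ∧ E u = none := by
      rintro B ⟨hB, hB'⟩
      obtain ⟨u, hu⟩ := P.nonempty_of_mem_parts hB
      have hu' := hu
      rw [hB', mem_barSet, ← P.part_eq_of_mem hB hu] at hu'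
      exact ⟨u, P.part_eq_of_mem hB hu,
        RepMap.apply_eq_apply_bar.1 (Finpartition.mem_part_ofSetoid_iff_rel.1 hu')⟩
    obtain ⟨u, rfl, hu⟩ := key B h1
    obtain ⟨v, rfl, hv⟩ := key B' h2
    have : v ∈ P.part u := Finpartition.mem_part_ofSetoid_iff_rel.2 (hu.trans hv.symm)
    exact (P.part_eq_of_mem (P.part_mem.2 (mem_univ u)) this).symm
  barSet_mem B hB := by
    set P := Finpartition.ofSetoid (Setoid.ker E.toFun)
    obtain ⟨u, hu⟩ := P.nonempty_of_mem_parts hB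
    have h1 : barSet B = P.part (bar u) := by
      ext v
      rw [mem_barSet, ← P.part_eq_of_mem hB hu, Finpartition.mem_part_ofSetoid_iff_rel,
        Finpartition.mem_part_ofSetoid_iff_rel]
      change E u = E (bar v) ↔ E (bar u) = E v
      constructor <;> intro h
      · rw [E.map_bar, h, ← E.map_bar, bar_bar]
      · rw [E.map_bar, ← h, ← E.map_bar, bar_bar]
    rw [h1]
    exact P.part_mem.2 (mem_univ _)
  barSet_eq_iff B hB := by simp [hB]

theorem repMap_ofRepMap (σ : Sg) (E : RepMap n) : (ofRepMap σ E).repMap = E := by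
  have hmem : ∀ u v, v ∈ (ofRepMap σ E).part.part u ↔ E u = E v := fun u v => by
    classical
    exact Finpartition.mem_part_ofSetoid_iff_rel (s := Setoid.ker E.toFun)
  refine RepMap.ext_apply fun u => ?_
  cases h : E u with
  | none =>
    refine rep_eq_none_iff.2 ((hmem _ _).2 ?_)
    exact RepMap.apply_eq_apply_bar.2 h
  | some v =>
    refine rep_eq_some_iff.2 ⟨?_, ?_, ?_⟩
    · rw [hmem, RepMap.apply_eq_apply_bar, h]
      simp
    · rw [hmem, h, E.idem h]
    · intro w hw
      rw [hmem, h] at hw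
      exact E.fst_le hw.symm

theorem repMap_injective [Subsingleton Sg] [DecidableEq Sg] :
    Function.Injective (repMap : LabeledPartition n Sg → RepMap n) := fun _ _ h =>
  le_antisymm (le_iff.2 h.le) (le_iff.2 h.ge)

instance [Subsingleton Sg] : Finite (LabeledPartition n Sg) := by
  classical
  exact Finite.of_injective _ repMap_injective

theorem signedBlock_eq_zero [Subsingleton Sg] [DecidableEq Sg] (x : LabeledPartition n Sg)
    (σ : Sg) : x.signedBlock σ = x.repMap.zero := by
  ext u
  rw [signedBlock, mem_filter, RepMap.mem_zero, repMap_eq_none_iff]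
  simp only [mem_univ, true_and]
  exact ⟨fun h => ⟨σ, h⟩, fun ⟨τ, hτ⟩ => by rw [hτ, Subsingleton.elim τ σ]⟩

theorem repMap_finest (u : DoubleSet n) : (finest n Sg).repMap u = some u := by
  have h : (finest n Sg).part.part u = {u} :=
    (finest n Sg).part.part_eq_of_mem (Finpartition.mem_bot_iff.2 ⟨u, mem_univ u, rfl⟩)
      (mem_singleton_self u)
  refine rep_eq_some_iff.2 ?_
  rw [h]
  simp [bar_ne]

theorem repMap_full (hn : 0 < n) (σ : Sg) (u : DoubleSet n) : (full n hn σ).repMap u = none := by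
  have h : (full n hn σ).part.part u = univ :=
    (full n hn σ).part.part_eq_of_mem (by simp [full]) (mem_univ u)
  refine rep_eq_none_iff.2 ?_
  rw [h]
  exact mem_univ _

end LabeledPartition

/-! ### Edge labels in terms of roots. -/

namespace LabeledPartition

variable {n : ℕ} {Sg : Type*}

theorem isUnsigned_part_of_root {x : LabeledPartition n Sg} {r : Fin n}
    (hr : r ∈ x.repMap.roots) : x.IsUnsigned (x.part.part (r, false)) := by
  refine ⟨x.part.part_mem.2 (mem_univ _), ?_⟩
  rw [RepMap.mem_roots] at hr
  have h : ¬ ∃ σ, x.label (x.part.part (r, false)) = some σ := by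
    rw [← repMap_eq_none_iff, hr]
    simp
  by_contra h1
  exact h (Option.ne_none_iff_exists'.1 h1)

theorem representative_part_of_root {x : LabeledPartition n Sg} {r : Fin n}
    (hr : r ∈ x.repMap.roots) : representative (x.part.part (r, false)) = r + 1 := by
  rw [RepMap.mem_roots] at hr
  refine IsLeast.csInf_eq ⟨⟨(r, false), x.part.mem_part (mem_univ _), rfl⟩, ?_⟩
  rintro i ⟨v, hv, rfl⟩
  exact Nat.succ_le_succ ((rep_eq_some_iff.1 hr).2.2 v hv)

theorem isNormalized_part_of_root {x : LabeledPartition n Sg} {r : Fin n}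
    (hr : r ∈ x.repMap.roots) : IsNormalized (x.part.part (r, false)) :=
  ⟨r, (representative_part_of_root hr).symm, x.part.mem_part (mem_univ _)⟩

theorem exists_root_of_isNormalized {x : LabeledPartition n Sg} {R : Finset (DoubleSet n)}
    (hR : x.IsUnsigned R) (hN : IsNormalized R) :
    ∃ r ∈ x.repMap.roots, x.part.part (r, false) = R := by
  obtain ⟨r, hr, hmem⟩ := hN
  have hpart := x.part.part_eq_of_mem hR.1 hmem
  refine ⟨r, ?_, hpart⟩
  rw [RepMap.mem_roots]
  refine rep_eq_some_iff.2 ⟨?_, x.part.mem_part (mem_univ _), fun w hw => ?_⟩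
  · rw [bar_mem_part_iff, hpart, hR.2]
    simp
  · rw [hpart] at hw
    have h : representative R ≤ w.1 + 1 := Nat.sInf_le ⟨w, hw, rfl⟩
    rw [← hr] at h
    exact Nat.le_of_succ_le_succ h

section label

/-- Since `edgeLabel` is a choice, computing it requires both a label and its uniqueness. -/
theorem edgeLabel_eq [Fintype Sg] [LinearOrder Sg] {x y : LabeledPartitionPoset n Sg}
    {l : ℕ ×ₗ ℕ} (h : IsEdgeLabel x y l) (h' : ∀ l', IsEdgeLabel x y l' → l' = l) :
    edgeLabel x y = l :=
  h' _ (Classical.epsilon_spec (p := IsEdgeLabel x y) ⟨l, h⟩)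

variable [Fintype Sg] [LinearOrder Sg] [Subsingleton Sg]

/-- Normalized unsigned blocks are exactly the blocks of the elements `(r, false)` with `r` a root,
and the counts in a signed label are `1` because there is only one sign. -/
theorem isEdgeLabel_cases {x y : LabeledPartition n Sg} {l : ℕ ×ₗ ℕ}
    (h : IsEdgeLabel (x : LabeledPartitionPoset n Sg) y l) :
    (∃ r ∈ x.repMap.roots, ∃ r' ∈ x.repMap.roots, r ≠ r' ∧
      y.repMap (r, false) = y.repMap (r', false) ∧
      l = toLex (0, max ((r : ℕ) + 1) ((r' : ℕ) + 1))) ∨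
    (∃ r ∈ x.repMap.roots, ∃ r' ∈ x.repMap.roots, r ≠ r' ∧
      y.repMap (r, false) = y.repMap (r', true) ∧
      l = toLex (2, min ((r : ℕ) + 1) ((r' : ℕ) + 1))) ∨
    (x.repMap.zero ⊂ y.repMap.zero ∧ l = toLex (1, 1)) := by
  generalize hX : (x : LabeledPartitionPoset n Sg) = X at h
  generalize hY : (y : LabeledPartitionPoset n Sg) = Y at h
  cases h with
  | coherent x y R R' hR hR' hne hN hN' hy =>
    obtain rfl := WithTop.coe_injective hX
    obtain rfl := WithTop.coe_injective hY
    obtain ⟨r, hr, rfl⟩ := exists_root_of_isNormalized hR hN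
    obtain ⟨r', hr', rfl⟩ := exists_root_of_isNormalized hR' hN'
    refine Or.inl ⟨r, hr, r', hr', fun h => hne (by rw [h]), ?_, ?_⟩
    · rw [← mem_part_iff, Finpartition.part_eq_of_mem _ hy]
      · exact mem_union_left _ (by simp)
      · exact mem_union_right _ (by simp)
    · rw [representative_part_of_root hr, representative_part_of_root hr']
  | nonCoherent x y R R' hR hR' hne hN hN' hy =>
    obtain rfl := WithTop.coe_injective hX
    obtain rfl := WithTop.coe_injective hY
    obtain ⟨r, hr, rfl⟩ := exists_root_of_isNormalized hR hN
    obtain ⟨r', hr', rfl⟩ := exists_root_of_isNormalized hR' hN'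
    refine Or.inr (Or.inl ⟨r, hr, r', hr', fun h => hne (by rw [h]), ?_, ?_⟩)
    · rw [← mem_part_iff, Finpartition.part_eq_of_mem _ hy]
      · exact mem_union_left _ (by simp)
      · exact mem_union_right _ (by simp [bar])
    · rw [representative_part_of_root hr, representative_part_of_root hr']
  | oldSign x y σ h hσ =>
    obtain rfl := WithTop.coe_injective hX
    obtain rfl := WithTop.coe_injective hY
    rw [signedBlock_eq_zero, signedBlock_eq_zero] at h
    refine Or.inr (Or.inr ⟨h, ?_⟩)
    have : (x.signs.filter fun τ => τ ≤ σ) = {σ} := by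
      ext τ
      obtain rfl := Subsingleton.elim τ σ
      simpa using hσ
    rw [this, card_singleton]
  | newSign x y σ h hσ =>
    obtain rfl := WithTop.coe_injective hX
    obtain rfl := WithTop.coe_injective hY
    rw [signedBlock_eq_zero, signedBlock_eq_zero] at h
    refine Or.inr (Or.inr ⟨h, ?_⟩)
    have : ((univ.filter fun τ => τ ≤ σ) ∪ x.signs) = {σ} := by
      ext τ
      obtain rfl := Subsingleton.elim τ σ
      simp
    rw [this, card_singleton]
  | top x => exact absurd hY (WithTop.coe_ne_top)

/-- The Boolean of `w` decides coherence: the block of `b` is joined with the normalized block of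
`w.1` or with the bar of that block. -/
theorem edgeLabel_join {x y : LabeledPartition n Sg} {w : DoubleSet n} {b : Fin n}
    (hw : w.1 ∈ x.repMap.roots) (hb : b ∈ x.repMap.roots) (hwb : w.1 < b)
    (hy : y.repMap = x.repMap.join w b) :
    edgeLabel (x : LabeledPartitionPoset n Sg) y =
      if w.2 then toLex (2, (w.1 : ℕ) + 1) else toLex (0, (b : ℕ) + 1) := by
  have happ : ∀ r ∈ x.repMap.roots, y.repMap (r, false) =
      if r = b then some w else some (r, false) := by
    intro r hr
    rw [hy, RepMap.join_apply hw hwb, RepMap.mem_roots.1 hr]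
    split_ifs <;> simp_all
  have happ' : ∀ r ∈ x.repMap.roots, y.repMap (r, true) =
      if r = b then some (bar w) else some (r, true) := by
    intro r hr
    have h : (r, true) = bar (r, false) := rfl
    rw [h, y.repMap.map_bar, happ r hr]
    split_ifs <;> rfl
  have hlt : (w.1 : ℕ) < b := hwb
  obtain ⟨a, c⟩ := w
  dsimp only at hw hwb hlt ⊢
  refine edgeLabel_eq ?_ ?_
  · cases c with
    | false =>
      have := IsEdgeLabel.coherent x y (x.part.part (a, false)) (x.part.part (b, false))
        (isUnsigned_part_of_root hw) (isUnsigned_part_of_root hb) ?_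
        (isNormalized_part_of_root hw) (isNormalized_part_of_root hb) ?_
      · rw [representative_part_of_root hw, representative_part_of_root hb,
          max_eq_right (by omega)] at this
        exact this
      · intro h
        have h1 := representative_part_of_root hw
        rw [h, representative_part_of_root hb] at h1
        omega
      · have : x.part.part (a, false) ∪ x.part.part (b, false) = y.part.part (b, false) := by
          ext ⟨i, d⟩
          rw [mem_union, mem_part_iff, mem_part_iff, mem_part_iff, happ b hb, if_pos rfl, hy,
            RepMap.join_apply hw hwb, RepMap.mem_roots.1 hb, RepMap.mem_roots.1 hw]
          cases h : x.repMap (i, d) with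
          | none => simp
          | some v =>
            obtain ⟨j, e⟩ := v
            by_cases hj : j = b <;> cases e <;> simp [hj, bar, hwb.ne']
        rw [this]
        exact y.part.part_mem.2 (mem_univ _)
    | true =>
      have := IsEdgeLabel.nonCoherent x y (x.part.part (a, false)) (x.part.part (b, false))
        (isUnsigned_part_of_root hw) (isUnsigned_part_of_root hb) ?_
        (isNormalized_part_of_root hw) (isNormalized_part_of_root hb) ?_
      · rw [representative_part_of_root hw, representative_part_of_root hb,
          min_eq_left (by omega)] at this
        exact this
      · intro h
        have h1 := representative_part_of_root hw
        rw [h, representative_part_of_root hb] at h1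
        omega
      · have : x.part.part (a, false) ∪ barSet (x.part.part (b, false)) =
            y.part.part (a, false) := by
          ext ⟨i, d⟩
          rw [← part_bar, mem_union, mem_part_iff, mem_part_iff, mem_part_iff, happ a hw,
            if_neg hwb.ne, hy, x.repMap.map_bar,
            RepMap.join_apply hw hwb, RepMap.mem_roots.1 hb, RepMap.mem_roots.1 hw]
          cases h : x.repMap (i, d) with
          | none => simp
          | some v =>
            obtain ⟨j, e⟩ := v
            by_cases hj : j = b <;> cases e <;> simp [hj, bar, hwb.ne']
        rw [this]
        exact y.part.part_mem.2 (mem_univ _)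
  · intro l hl
    rcases isEdgeLabel_cases hl with ⟨r, hr, r', hr', hne, h, rfl⟩ | ⟨r, hr, r', hr', hne, h, rfl⟩ |
      ⟨h, -⟩
    · rw [happ r hr, happ r' hr'] at h
      split_ifs at h with h1 h2 h2
      · exact absurd (h1.trans h2.symm) hne
      · subst h1
        simp only [Option.some.injEq, Prod.mk.injEq] at h
        obtain ⟨rfl, rfl⟩ := h
        rw [max_eq_left (by omega)]
        rfl
      · subst h2
        simp only [Option.some.injEq, Prod.mk.injEq] at h
        obtain ⟨rfl, rfl⟩ := h
        rw [max_eq_right (by omega)]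
        rfl
      · simp only [Option.some.injEq, Prod.mk.injEq] at h
        exact absurd h.1 hne
    · rw [happ r hr, happ' r' hr'] at h
      split_ifs at h with h1 h2 h2
      · exact absurd (h1.trans h2.symm) hne
      · subst h1
        simp only [Option.some.injEq, Prod.mk.injEq] at h
        obtain ⟨rfl, rfl⟩ := h
        rw [min_eq_right (by omega)]
        rfl
      · subst h2
        simp only [Option.some.injEq, Prod.mk.injEq, bar] at h
        obtain ⟨rfl, h⟩ := h
        rw [min_eq_left (by omega)]
        cases c with
        | false => simp at h
        | true => rfl
      · simp at h
    · rw [hy, RepMap.zero_join hw hwb] at h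
      exact absurd h (ssubset_irrefl _)

theorem edgeLabel_sign (σ : Sg) {x y : LabeledPartition n Sg} {a : Fin n}
    (ha : a ∈ x.repMap.roots) (hy : y.repMap = x.repMap.sign a) :
    edgeLabel (x : LabeledPartitionPoset n Sg) y = toLex (1, 1) := by
  have hz : x.repMap.zero ⊂ y.repMap.zero := hy ▸ RepMap.zero_ssubset_zero_sign ha
  have happ : ∀ r ∈ x.repMap.roots, y.repMap (r, false) =
      if r = a then none else some (r, false) := by
    intro r hr
    rw [hy, RepMap.sign_apply, RepMap.mem_roots.1 hr]
    rfl
  have happ' : ∀ r ∈ x.repMap.roots, y.repMap (r, true) =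
      if r = a then none else some (r, true) := by
    intro r hr
    have h : (r, true) = bar (r, false) := rfl
    rw [h, y.repMap.map_bar, happ r hr]
    split_ifs <;> rfl
  have huniq : ∀ l', IsEdgeLabel (x : LabeledPartitionPoset n Sg) y l' → l' = toLex (1, 1) := by
    intro l hl
    rcases isEdgeLabel_cases hl with ⟨r, hr, r', hr', hne, h, -⟩ | ⟨r, hr, r', hr', hne, h, -⟩ |
      ⟨-, h⟩
    · rw [happ r hr, happ r' hr'] at h
      split_ifs at h with h1 h2 h2
      · exact absurd (h1.trans h2.symm) hne
      · simp only [Option.some.injEq, Prod.mk.injEq] at h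
        exact absurd h.1 hne
    · rw [happ r hr, happ' r' hr'] at h
      split_ifs at h with h1 h2 h2
      · exact absurd (h1.trans h2.symm) hne
      · simp at h
    · exact h
  have hs : x.signedBlock σ ⊂ y.signedBlock σ := by
    rwa [signedBlock_eq_zero, signedBlock_eq_zero]
  by_cases hσ : σ ∈ x.signs
  · have h := IsEdgeLabel.oldSign x y σ hs hσ
    rw [huniq _ h] at h
    exact edgeLabel_eq h huniq
  · have h := IsEdgeLabel.newSign x y σ hs hσ
    rw [huniq _ h] at h
    exact edgeLabel_eq h huniq

end label

/-! ### The subposets of types B, C, D and their covers. -/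

/-- The subposet of all labeled partitions if `d` is false, and of those whose signed block does not
have exactly two elements if `d` is true. -/
def subposet (n : ℕ) (Sg : Type*) (d : Prop) : Set (LabeledPartitionPoset n Sg) :=
  {x | ∀ π : LabeledPartition n Sg, x = (π : LabeledPartitionPoset n Sg) →
    d → π.repMap.zero.card ≠ 2}

theorem coe_mem_subposet {d : Prop} {x : LabeledPartition n Sg} :
    (x : LabeledPartitionPoset n Sg) ∈ subposet n Sg d ↔ (d → x.repMap.zero.card ≠ 2) :=
  ⟨fun h => h x rfl, fun h π hπ => by rwa [← WithTop.coe_injective hπ]⟩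

theorem typeB_eq [Subsingleton Sg] [DecidableEq Sg] (σ : Sg) :
    typeB n σ = subposet n Sg False := by
  ext x
  simp only [typeB, subposet, Set.mem_ofPred_eq]
  exact ⟨fun _ _ _ h => h.elim, fun _ _ _ τ h => absurd (Subsingleton.elim τ σ) h⟩

theorem typeC_eq : typeC n Sg = subposet n Sg False := by
  ext x
  simp [typeC, subposet]

theorem typeD_eq [Subsingleton Sg] [DecidableEq Sg] (σ : Sg) :
    typeD n Sg = subposet n Sg True := by
  ext x
  simp only [typeD, subposet, Set.mem_ofPred_eq, signedBlock_eq_zero]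
  exact forall_congr' fun π => forall_congr' fun _ => ⟨fun h _ => h σ, fun h _ => h trivial⟩

/-- A nonempty signed block is closed under bar, so it has at least two elements and any enlargement
has more. The restriction of type D therefore concerns only the first signed edge. -/
theorem sign_mem_subposet {d : Prop} {σ : Sg} {x : LabeledPartition n Sg} {a : Fin n}
    (ha : a ∈ x.repMap.roots) (hz : x.repMap.zero.Nonempty) :
    (ofRepMap σ (x.repMap.sign a) : LabeledPartitionPoset n Sg) ∈ subposet n Sg d := by
  rw [coe_mem_subposet]
  intro hd
  rw [repMap_ofRepMap]
  have h1 := card_lt_card (RepMap.zero_ssubset_zero_sign ha)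
  obtain ⟨u, hu⟩ := hz
  have h2 : ({u, bar u} : Finset (DoubleSet n)).card ≤ x.repMap.zero.card := by
    refine card_le_card fun v hv => ?_
    rw [RepMap.mem_zero] at hu ⊢
    rw [mem_insert, mem_singleton] at hv
    rcases hv with rfl | rfl
    · exact hu
    · exact RepMap.apply_bar_eq_none.2 hu
  rw [card_pair (bar_ne u).symm] at h2
  omega

theorem sign_injOn (σ : Sg) (E : RepMap n) : Set.InjOn
    (fun a => ((ofRepMap σ (E.sign a) : LabeledPartition n Sg) : LabeledPartitionPoset n Sg))
    E.roots := by
  intro a ha b _ h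
  have h1 := congrArg repMap (WithTop.coe_injective h)
  rw [repMap_ofRepMap, repMap_ofRepMap] at h1
  have h2 := RepMap.roots_sign E a
  rw [h1, RepMap.roots_sign] at h2
  by_contra hab
  have h3 : a ∈ E.roots.erase b := mem_erase.2 ⟨hab, ha⟩
  rw [h2] at h3
  simp at h3

theorem eq_full_iff [Subsingleton Sg] [DecidableEq Sg] {hn : 0 < n} {σ : Sg}
    {x : LabeledPartition n Sg} :
    x = full n hn σ ↔ x.repMap.roots = ∅ := by
  constructor
  · rintro rfl
    rw [eq_empty_iff_forall_notMem]
    intro r hr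
    rw [RepMap.mem_roots, repMap_full] at hr
    simp at hr
  · intro h
    refine repMap_injective (RepMap.ext_apply fun u => ?_)
    rw [repMap_full]
    by_contra h1
    obtain ⟨v, hv⟩ := Option.ne_none_iff_exists'.1 h1
    have := RepMap.mem_roots_of_apply hv
    rw [h] at this
    simp at this

theorem coe_ne_full [Subsingleton Sg] [DecidableEq Sg] {hn : 0 < n} {σ : Sg}
    {x : LabeledPartition n Sg} (h : x.repMap.roots.Nonempty) :
    (x : LabeledPartitionPoset n Sg) ≠ full n hn σ := fun h1 =>
  h.ne_empty (eq_full_iff.1 (WithTop.coe_injective h1))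

section covBy

variable [DecidableEq Sg] [Subsingleton Sg] {d : Prop}

theorem eq_of_covBy_of_lt_of_le {x y z : LabeledPartition n Sg}
    {hx : (x : LabeledPartitionPoset n Sg) ∈ subposet n Sg d}
    {hy : (y : LabeledPartitionPoset n Sg) ∈ subposet n Sg d}
    (h : (⟨x, hx⟩ : subposet n Sg d) ⋖ ⟨y, hy⟩)
    (hz : (z : LabeledPartitionPoset n Sg) ∈ subposet n Sg d)
    (hxz : x.repMap < z.repMap) (hzy : z.repMap ≤ y.repMap) : z.repMap = y.repMap := by
  by_contra hne
  have key : ∀ {u v : LabeledPartition n Sg}, u.repMap < v.repMap → u < v := fun {u v} huv =>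
    lt_of_le_not_ge (le_iff.2 huv.le) fun h => not_le_of_gt huv (le_iff.1 h)
  refine h.2 (c := ⟨z, hz⟩) ?_ ?_
  · exact Subtype.mk_lt_mk.2 (WithTop.coe_lt_coe.2 (key hxz))
  · exact Subtype.mk_lt_mk.2 (WithTop.coe_lt_coe.2 (key (lt_of_le_of_ne hzy hne)))

theorem covBy_of_card_roots {x y : LabeledPartition n Sg}
    {hx : (x : LabeledPartitionPoset n Sg) ∈ subposet n Sg d}
    {hy : (y : LabeledPartitionPoset n Sg) ∈ subposet n Sg d}
    (h : x.repMap < y.repMap) (hc : x.repMap.roots.card ≤ y.repMap.roots.card + 1) :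
    (⟨x, hx⟩ : subposet n Sg d) ⋖ ⟨y, hy⟩ := by
  have key : ∀ {u v : LabeledPartition n Sg}, u < v → u.repMap < v.repMap := fun {u v} huv =>
    lt_of_le_not_ge (le_iff.1 huv.le) fun h => not_le_of_gt huv (le_iff.2 h)
  constructor
  · exact Subtype.mk_lt_mk.2 (WithTop.coe_lt_coe.2
      (lt_of_le_not_ge (le_iff.2 h.le) fun h' => not_le_of_gt h (le_iff.1 h')))
  · rintro ⟨z, hz⟩ h1 h2
    rw [Subtype.mk_lt_mk] at h1 h2
    induction z using WithTop.recTopCoe with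
    | top => exact absurd h2 (not_lt_of_ge le_top)
    | coe z =>
      rw [WithTop.coe_lt_coe] at h1 h2
      have h3 := RepMap.card_roots_lt_of_lt (key h1)
      have h4 := RepMap.card_roots_lt_of_lt (key h2)
      omega

/-- Elementary moves lose exactly one root, hence are covers. Conversely, a root `r` lost by a cover
is either represented by a smaller element, which gives a join below `y`, or signed, which gives
`sign r` below `y`. The delicate case is that `sign r` is missing from the type D subposet. -/
theorem covBy_iff (σ : Sg) {x y : LabeledPartition n Sg}
    {hx : (x : LabeledPartitionPoset n Sg) ∈ subposet n Sg d}
    {hy : (y : LabeledPartitionPoset n Sg) ∈ subposet n Sg d} :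
    (⟨x, hx⟩ : subposet n Sg d) ⋖ ⟨y, hy⟩ ↔
      (∃ w b, w.1 ∈ x.repMap.roots ∧ b ∈ x.repMap.roots ∧ w.1 < b ∧
        y.repMap = x.repMap.join w b) ∨
      ∃ a ∈ x.repMap.roots, y.repMap = x.repMap.sign a := by
  constructor
  · intro h
    have hlt : x < y := WithTop.coe_lt_coe.1 (Subtype.mk_lt_mk.1 h.1)
    have hle := le_iff.1 hlt.le
    have hlt' : x.repMap < y.repMap := lt_of_le_of_ne hle fun h => hlt.ne (repMap_injective h)
    have hjoin : ∀ w b, w.1 ∈ x.repMap.roots → b ∈ x.repMap.roots → w.1 < b →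
        x.repMap.join w b ≤ y.repMap → y.repMap = x.repMap.join w b := by
      intro w b hw hb hwb hle'
      have := eq_of_covBy_of_lt_of_le (z := ofRepMap σ (x.repMap.join w b)) h ?_ ?_ ?_
      · rw [← this, repMap_ofRepMap]
      · rw [coe_mem_subposet, repMap_ofRepMap, RepMap.zero_join hw hwb]
        exact coe_mem_subposet.1 hx
      · rw [repMap_ofRepMap]
        exact RepMap.lt_join hw hb hwb
      · rwa [repMap_ofRepMap]
    obtain ⟨r, hr, hr'⟩ := RepMap.exists_root_of_lt hlt'
    cases hyr : y.repMap (r, false) with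
    | some w =>
      have hwr : w.1 ≠ r := by
        rintro rfl
        exact hr' (RepMap.mem_roots_of_apply hyr)
      have hwr : w.1 < r := lt_of_le_of_ne (y.repMap.fst_le hyr) hwr
      have hw := RepMap.roots_subset_of_le hle (RepMap.mem_roots_of_apply hyr)
      exact Or.inl ⟨w, r, hw, hr, hwr, hjoin w r hw hr hwr
        (RepMap.join_le hle hw hwr (hyr.trans (y.repMap.idem hyr).symm))⟩
    | none =>
      have hsle := RepMap.sign_le hle hyr
      by_cases hd : d → (x.repMap.sign r).zero.card ≠ 2
      · refine Or.inr ⟨r, hr, ?_⟩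
        have := eq_of_covBy_of_lt_of_le (z := ofRepMap σ (x.repMap.sign r)) h ?_ ?_ ?_
        · rw [← this, repMap_ofRepMap]
        · rwa [coe_mem_subposet, repMap_ofRepMap]
        · rw [repMap_ofRepMap]
          exact RepMap.lt_sign hr
        · rwa [repMap_ofRepMap]
      -- Here the signed block of `sign r` is just `{r, r̄}`, so `x` has no signed block, while `y`
      -- absorbs a further root. Joining that root with `r` stays in the subposet and below `y`, so
      -- the cover would be this join; but a join creates no signed block.
      · exfalso
        push Not at hd
        obtain ⟨hd, hcard⟩ := hd
        have hycard := coe_mem_subposet.1 hy hd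
        have hsub := RepMap.zero_subset_of_le hsle
        have hpair : ({(r, false), (r, true)} : Finset (DoubleSet n)) =
            (x.repMap.sign r).zero := by
          refine eq_of_subset_of_card_le ?_ (by rw [hcard]; simp)
          have h1 : x.repMap.sign r (r, false) = none :=
            RepMap.sign_apply_eq_none.2 (Or.inr ⟨_, RepMap.mem_roots.1 hr, rfl⟩)
          have h2 : x.repMap.sign r (r, true) = none :=
            RepMap.apply_bar_eq_none (u := (r, false)).2 h1
          intro u hu
          rw [mem_insert, mem_singleton] at hu
          rw [RepMap.mem_zero]
          rcases hu with rfl | rfl <;> assumption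
        have hfst : ∀ u, x.repMap.sign r u = none → u.1 = r := by
          intro u hu
          rw [← RepMap.mem_zero, ← hpair, mem_insert, mem_singleton] at hu
          rcases hu with rfl | rfl <;> rfl
        obtain ⟨u, huy, hus⟩ : ∃ u ∈ y.repMap.zero, u ∉ (x.repMap.sign r).zero := by
          by_contra! hcon
          exact hycard (by rw [← subset_antisymm hsub hcon, hcard])
        rw [RepMap.mem_zero] at huy hus
        rw [RepMap.sign_apply_eq_none, not_or, not_exists] at hus
        obtain ⟨v, hv⟩ := Option.ne_none_iff_exists'.1 hus.1
        have hvr : v.1 ≠ r := fun h => hus.2 v ⟨hv, h⟩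
        have hvroot := RepMap.mem_roots_of_apply hv
        have hvy : y.repMap (v.1, false) = none := by
          rw [RepMap.apply_eq_of_le hle hv] at huy
          obtain ⟨i, c⟩ := v
          cases c with
          | false => exact huy
          | true => exact RepMap.apply_bar_eq_none (u := (i, true)).2 huy
        have hxzero : x.repMap.zero = ∅ := by
          rw [eq_empty_iff_forall_notMem]
          intro u' hu'
          rw [RepMap.mem_zero] at hu'
          have h1 := hfst u' (RepMap.sign_apply_eq_none.2 (Or.inl hu'))
          obtain ⟨i, c⟩ := u'
          obtain rfl : i = r := h1
          have h2 := RepMap.fst_mem_roots (w := (i, c)).1 hr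
          rw [hu'] at h2
          simp at h2
        have hyz : ∀ w b, w.1 ∈ x.repMap.roots → w.1 < b →
            y.repMap ≠ x.repMap.join w b := by
          intro w b hw hwb he
          have h1 := RepMap.zero_join hw hwb
          rw [← he, hxzero, eq_empty_iff_forall_notMem] at h1
          exact h1 u (RepMap.mem_zero.2 huy)
        rcases lt_or_gt_of_ne hvr with h1 | h1
        · refine hyz (v.1, false) r hvroot h1 (hjoin _ _ hvroot hr h1 ?_)
          exact RepMap.join_le hle hvroot h1 (hyr.trans hvy.symm)
        · refine hyz (r, false) v.1 hr h1 (hjoin _ _ hr hvroot h1 ?_)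
          exact RepMap.join_le hle hr h1 (hvy.trans hyr.symm)
  · rintro (⟨w, b, hw, hb, hwb, h⟩ | ⟨a, ha, h⟩)
    · refine covBy_of_card_roots (h ▸ RepMap.lt_join hw hb hwb) ?_
      rw [h, RepMap.roots_join hw hwb, card_erase_add_one hb]
    · refine covBy_of_card_roots (h ▸ RepMap.lt_sign ha) ?_
      rw [h, RepMap.roots_sign, card_erase_add_one ha]

end covBy

end LabeledPartition

/-! ### Counting decreasing chains by their first edge. -/

namespace LabeledPartition

variable {n : ℕ} {Sg : Type*} [Fintype Sg] [LinearOrder Sg]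

/-- The decreasing chains of covers in `Q` from `x` to `z` whose labels are at most `l`. -/
def chainsFrom (Q : Set (LabeledPartitionPoset n Sg)) (z : LabeledPartitionPoset n Sg)
    (l : ℕ ×ₗ ℕ) (x : LabeledPartitionPoset n Sg) : Set (List Q) :=
  {c | c.IsChain (· ⋖ ·) ∧ (c.map Subtype.val).head? = some x ∧
    (c.map Subtype.val).getLast? = some z ∧
    (l :: labelWord (c.map Subtype.val)).Pairwise (· ≥ ·)}

theorem toLex_le_toLex_iff {a b c d : ℕ} :
    (toLex (a, b) : ℕ ×ₗ ℕ) ≤ toLex (c, d) ↔ a < c ∨ a = c ∧ b ≤ d := by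
  rw [Prod.Lex.le_iff]
  rfl

theorem labelWord_cons_cons (x y : LabeledPartitionPoset n Sg)
    (c : List (LabeledPartitionPoset n Sg)) :
    labelWord (x :: y :: c) = edgeLabel x y :: labelWord (y :: c) := rfl

theorem pairwise_ge_cons_cons {α : Type*} [LinearOrder α] {a b : α} {c : List α} :
    (a :: b :: c).Pairwise (· ≥ ·) ↔ b ≤ a ∧ (b :: c).Pairwise (· ≥ ·) := by
  rw [← List.isChain_iff_pairwise, ← List.isChain_iff_pairwise, List.isChain_cons_cons]

theorem cons_cons_mem_chainsFrom {Q : Set (LabeledPartitionPoset n Sg)}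
    {z x : LabeledPartitionPoset n Sg} {l : ℕ ×ₗ ℕ} {X Y : Q} {c : List Q} :
    X :: Y :: c ∈ chainsFrom Q z l x ↔ X.1 = x ∧ X ⋖ Y ∧ edgeLabel X.1 Y.1 ≤ l ∧
      Y :: c ∈ chainsFrom Q z (edgeLabel X.1 Y.1) Y.1 := by
  simp only [chainsFrom, Set.mem_ofPred_eq, List.map_cons, List.head?_cons,
    List.getLast?_cons_cons, labelWord_cons_cons, pairwise_ge_cons_cons, List.isChain_cons_cons,
    Option.some.injEq, true_and]
  tauto

theorem singleton_mem_chainsFrom {Q : Set (LabeledPartitionPoset n Sg)}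
    {z x : LabeledPartitionPoset n Sg} {l : ℕ ×ₗ ℕ} {X : Q} :
    [X] ∈ chainsFrom Q z l x ↔ X.1 = x ∧ X.1 = z := by
  simp [chainsFrom, labelWord]

theorem nil_notMem_chainsFrom {Q : Set (LabeledPartitionPoset n Sg)}
    {z x : LabeledPartitionPoset n Sg} {l : ℕ ×ₗ ℕ} : [] ∉ chainsFrom Q z l x := by
  simp [chainsFrom]

theorem exists_cons_of_mem_chainsFrom {Q : Set (LabeledPartitionPoset n Sg)}
    {z : LabeledPartitionPoset n Sg} {l : ℕ ×ₗ ℕ} {X : Q} {c : List Q}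
    (hc : c ∈ chainsFrom Q z l X) : ∃ c', c = X :: c' := by
  cases c with
  | nil => exact absurd hc nil_notMem_chainsFrom
  | cons Y c =>
    have h : some Y.1 = some X.1 := hc.2.1
    exact ⟨c, by rw [Subtype.ext (Option.some.inj h)]⟩

open Classical in
-- The first edge must have a label at most `l`, and its own label becomes the bound for the rest of
-- the chain.
theorem encard_chainsFrom (Q : Set (LabeledPartitionPoset n Sg)) [Fintype Q]
    (z : LabeledPartitionPoset n Sg) (l : ℕ ×ₗ ℕ) (X : Q) :
    (chainsFrom Q z l X).encard = (if X.1 = z then 1 else 0) +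
      ∑ Y : Q with X ⋖ Y ∧ edgeLabel X.1 Y.1 ≤ l,
        (chainsFrom Q z (edgeLabel X.1 Y.1) Y).encard := by
  have h1 : chainsFrom Q z l X = (if X.1 = z then {[X]} else ∅) ∪
      ⋃ Y ∈ (univ.filter fun Y : Q => X ⋖ Y ∧ edgeLabel X.1 Y.1 ≤ l : Finset Q),
        List.cons X '' chainsFrom Q z (edgeLabel X.1 Y.1) Y := by
    ext c
    simp only [Set.mem_union, Set.mem_iUnion, mem_filter, mem_univ, true_and, exists_prop,
      Set.mem_image]
    constructor
    · intro hc
      obtain ⟨c, rfl⟩ := exists_cons_of_mem_chainsFrom hc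
      cases c with
      | nil =>
        left
        rw [if_pos (singleton_mem_chainsFrom.1 hc).2]
        rfl
      | cons Y c =>
        obtain ⟨-, h1, h2, h3⟩ := cons_cons_mem_chainsFrom.1 hc
        exact Or.inr ⟨Y, ⟨h1, h2⟩, _, h3, rfl⟩
    · rintro (hc | ⟨Y, ⟨h1, h2⟩, c, hc, rfl⟩)
      · split_ifs at hc with h
        · obtain rfl : c = [X] := hc
          exact singleton_mem_chainsFrom.2 ⟨rfl, h⟩
        · exact hc.elim
      · obtain ⟨c, rfl⟩ := exists_cons_of_mem_chainsFrom hc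
        exact cons_cons_mem_chainsFrom.2 ⟨rfl, h1, h2, hc⟩
  rw [h1, Set.encard_union_eq]
  · congr 1
    · split_ifs <;> simp
    · have := Set.Finite.encard_biUnion
        (univ.filter fun Y : Q => X ⋖ Y ∧ edgeLabel X.1 Y.1 ≤ l : Finset Q).finite_toSet
        (s := fun Y => List.cons X '' chainsFrom Q z (edgeLabel X.1 Y.1) Y) ?_
      · simp only [mem_coe] at this
        rw [this, finsum_mem_finset_eq_sum]
        refine sum_congr rfl fun Y _ => ?_
        exact Function.Injective.encard_image (List.cons_injective) _
      · intro Y _ Y' _ hne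
        refine Set.disjoint_left.2 ?_
        rintro _ ⟨c, hc, rfl⟩ ⟨c', hc', h⟩
        obtain ⟨c, rfl⟩ := exists_cons_of_mem_chainsFrom hc
        obtain ⟨c', rfl⟩ := exists_cons_of_mem_chainsFrom hc'
        simp only [List.cons.injEq, true_and] at h
        exact hne h.1.symm
  · refine Set.disjoint_left.2 fun c hc hc' => ?_
    split_ifs at hc
    · obtain rfl : c = [X] := hc
      simp only [Set.mem_iUnion, Set.mem_image] at hc'
      obtain ⟨Y, -, c, hc, h⟩ := hc'
      obtain ⟨c', rfl⟩ := exists_cons_of_mem_chainsFrom hc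
      simp at h
    · exact hc

variable [Subsingleton Sg]

/-- The index set parametrizes elementary moves; permitted covers outside it may be ignored if they
start no chain to `z`. -/
theorem encard_chainsFrom_eq_sum {ι : Type*} {Q : Set (LabeledPartitionPoset n Sg)}
    {z : LabeledPartitionPoset n Sg} {l : ℕ ×ₗ ℕ} {X : Q} (hne : X.1 ≠ z) (s : Finset ι)
    (g : ι → LabeledPartitionPoset n Sg) (hinj : Set.InjOn g s)
    (hg : ∀ i ∈ s, ∃ hi : g i ∈ Q, X ⋖ ⟨g i, hi⟩ ∧ edgeLabel X.1 (g i) ≤ l)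
    (hg' : ∀ Y : Q, X ⋖ Y → edgeLabel X.1 Y.1 ≤ l →
      (chainsFrom Q z (edgeLabel X.1 Y.1) Y).encard ≠ 0 → ∃ i ∈ s, g i = Y.1) :
    (chainsFrom Q z l X).encard =
      ∑ i ∈ s, (chainsFrom Q z (edgeLabel X.1 (g i)) (g i)).encard := by
  classical
  have := Fintype.ofFinite Q
  rw [encard_chainsFrom, if_neg hne, zero_add, ← sum_attach s]
  symm
  refine sum_of_injOn (fun i => (⟨g i.1, (hg i.1 i.2).1⟩ : Q)) ?_ ?_ ?_ ?_
  · intro i _ j _ h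
    exact Subtype.ext (hinj i.2 j.2 (congrArg Subtype.val h))
  · intro i _
    simpa using (hg i.1 i.2).2
  · intro Y hY hY'
    by_contra h
    obtain ⟨h1, h2⟩ := (mem_filter.1 hY).2
    obtain ⟨i, hi, hiY⟩ := hg' Y h1 h2 h
    exact hY' ⟨⟨i, hi⟩, by simp, Subtype.ext hiY⟩
  · intro i _
    rfl

theorem encard_chainsFrom_eq_zero {Q : Set (LabeledPartitionPoset n Sg)}
    {z : LabeledPartitionPoset n Sg} {l : ℕ ×ₗ ℕ} {X : Q} (hne : X.1 ≠ z)
    (h : ∀ Y : Q, X ⋖ Y → edgeLabel X.1 Y.1 ≤ l →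
      (chainsFrom Q z (edgeLabel X.1 Y.1) Y).encard = 0) :
    (chainsFrom Q z l X).encard = 0 := by
  rw [encard_chainsFrom_eq_sum hne (∅ : Finset ℕ) (fun _ => ⊤) (by simp) (by simp)
    fun Y h1 h2 h3 => absurd (h Y h1 h2) h3]
  simp

theorem encard_chainsFrom_top {Q : Set (LabeledPartitionPoset n Sg)} (z : LabeledPartition n Sg)
    (l : ℕ ×ₗ ℕ) {X : Q} (hX : X.1 = ⊤) :
    (chainsFrom Q (z : LabeledPartitionPoset n Sg) l X).encard = 0 := by
  refine encard_chainsFrom_eq_zero (by rw [hX]; exact WithTop.top_ne_coe) fun Y h _ => ?_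
  have h1 : X.1 < Y.1 := h.1
  rw [hX] at h1
  exact absurd h1 (not_lt_of_ge le_top)

variable {d : Prop} {hn : 0 < n} {σ : Sg}

/-- Under a bound `(0, b)` only coherent joins are allowed. Each keeps the root `w.1`, so the roots
never run out and `[n]_σ` is never reached. -/
theorem encard_chainsFrom_coherent {x : LabeledPartition n Sg} (b : ℕ)
    (hx : (x : LabeledPartitionPoset n Sg) ∈ subposet n Sg d) (hr : x.repMap.roots.Nonempty) :
    (chainsFrom (subposet n Sg d) (full n hn σ : LabeledPartition n Sg) (toLex (0, b))
      x).encard = 0 := by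
  induction hk : x.repMap.roots.card using Nat.strong_induction_on generalizing x b with
  | _ k ih =>
  refine encard_chainsFrom_eq_zero (Q := subposet n Sg d) (X := ⟨x, hx⟩) (coe_ne_full hr) ?_
  rintro ⟨Y, hY⟩ hcov hle
  induction Y using WithTop.recTopCoe with
  | top => exact encard_chainsFrom_top _ _ rfl
  | coe y =>
    rcases (covBy_iff σ).1 hcov with ⟨w, c, hw, hc, hwc, hy⟩ | ⟨a, ha, hy⟩
    · have hlab := edgeLabel_join hw hc hwc hy
      dsimp only at hle ⊢
      rw [hlab] at hle ⊢
      split_ifs at hle ⊢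
      · rw [toLex_le_toLex_iff] at hle
        omega
      · have hroots : y.repMap.roots = x.repMap.roots.erase c := by
          rw [hy, RepMap.roots_join hw hwc]
        refine ih _ ?_ _ hY ?_ rfl
        · rw [← hk, hroots]
          exact card_erase_lt_of_mem hc
        · exact ⟨w.1, by rw [hroots, mem_erase]; exact ⟨hwc.ne, hw⟩⟩
    · have hlab := edgeLabel_sign σ ha hy
      dsimp only at hle
      rw [hlab, toLex_le_toLex_iff] at hle
      omega

/-- Noncoherent joins exceed the bound and coherent ones are dead ends, so every step signs one of
the remaining roots, in an arbitrary order. -/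
theorem encard_chainsFrom_signed {x : LabeledPartition n Sg}
    (hx : (x : LabeledPartitionPoset n Sg) ∈ subposet n Sg d) (hz : x.repMap.zero.Nonempty) :
    (chainsFrom (subposet n Sg d) (full n hn σ : LabeledPartition n Sg) (toLex (1, 1))
      x).encard = (x.repMap.roots.card ! : ℕ) := by
  induction hk : x.repMap.roots.card generalizing x with
  | zero =>
    classical
    have := Fintype.ofFinite (subposet n Sg d)
    have hfull := eq_full_iff (hn := hn) (σ := σ).2 (card_eq_zero.1 hk)
    rw [encard_chainsFrom _ _ _ (⟨x, hx⟩ : subposet n Sg d),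
      if_pos (congrArg WithTop.some hfull), sum_eq_zero]
    · simp
    · rintro ⟨Y, hY⟩ hcov
      have hcov := (mem_filter.1 hcov).2.1
      induction Y using WithTop.recTopCoe with
      | top => exact encard_chainsFrom_top _ _ rfl
      | coe y =>
        rw [card_eq_zero] at hk
        rcases (covBy_iff σ).1 hcov with ⟨w, c, hw, -⟩ | ⟨a, ha, -⟩
        · rw [hk] at hw
          simp at hw
        · rw [hk] at ha
          simp at ha
  | succ k ih =>
    have hne : x.repMap.roots.Nonempty := card_pos.1 (by omega)
    have hlab : ∀ a ∈ x.repMap.roots, edgeLabel (x : LabeledPartitionPoset n Sg)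
        (ofRepMap σ (x.repMap.sign a) : LabeledPartition n Sg) = toLex (1, 1) := fun a ha =>
      edgeLabel_sign σ ha (repMap_ofRepMap _ _)
    rw [encard_chainsFrom_eq_sum (X := ⟨x, hx⟩) (coe_ne_full hne) x.repMap.roots
      (fun a => ((ofRepMap σ (x.repMap.sign a) : LabeledPartition n Sg) :
        LabeledPartitionPoset n Sg)) (sign_injOn σ _)]
    · rw [sum_congr rfl (g := fun _ => ((k ! : ℕ) : ℕ∞))]
      · rw [sum_const, hk, Nat.factorial_succ]
        simp
      · intro a ha
        dsimp only
        rw [hlab a ha]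
        refine ih (sign_mem_subposet ha hz) ?_ ?_
        · rw [repMap_ofRepMap]
          exact hz.mono (RepMap.zero_subset_of_le (RepMap.le_sign _ _))
        · rw [repMap_ofRepMap, RepMap.roots_sign, card_erase_of_mem ha, hk]
          rfl
    · intro a ha
      exact ⟨sign_mem_subposet ha hz,
        (covBy_iff σ).2 (Or.inr ⟨a, ha, repMap_ofRepMap _ _⟩), (hlab a ha).le⟩
    · rintro ⟨Y, hY⟩ hcov hle hcount
      induction Y using WithTop.recTopCoe with
      | top => exact absurd (encard_chainsFrom_top _ _ rfl) hcount
      | coe y =>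
        rcases (covBy_iff σ).1 hcov with ⟨w, c, hw, hc, hwc, hy⟩ | ⟨a, ha, hy⟩
        · have hlab := edgeLabel_join hw hc hwc hy
          dsimp only at hle hcount
          rw [hlab] at hle hcount
          split_ifs at hle hcount
          · rw [toLex_le_toLex_iff] at hle
            omega
          · refine absurd (encard_chainsFrom_coherent _ hY ⟨w.1, ?_⟩) hcount
            rw [hy, RepMap.roots_join hw hwc]
            exact mem_erase.2 ⟨hwc.ne, hw⟩
        · refine ⟨a, ha, ?_⟩
          dsimp only
          rw [repMap_injective ((repMap_ofRepMap σ (x.repMap.sign a)).trans hy.symm)]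

end LabeledPartition

/-! ### Unsigned partitions and the total count. -/

namespace RepMap

variable {n : ℕ}

/-- All blocks of `E` are unsigned, and `p` is the partition of `Fin n` that they induce. -/
def Lifts (E : RepMap n) (p : MinMap n) : Prop := ∀ i, ∃ c, E (i, false) = some (p i, c)

theorem Lifts.apply {E : RepMap n} {p : MinMap n} (h : E.Lifts p) (u : DoubleSet n) :
    ∃ c, E u = some (p u.1, c) := by
  obtain ⟨i, b⟩ := u
  obtain ⟨c, hc⟩ := h i
  cases b with
  | false => exact ⟨c, hc⟩
  | true =>
    refine ⟨!c, ?_⟩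
    have := E.map_bar (i, false)
    rw [hc] at this
    exact this

theorem Lifts.roots_eq {E : RepMap n} {p : MinMap n} (h : E.Lifts p) : E.roots = p.roots := by
  ext r
  rw [MinMap.mem_roots]
  constructor
  · intro hr
    obtain ⟨c, hc⟩ := h r
    rw [mem_roots.1 hr] at hc
    simp only [Option.some.injEq, Prod.mk.injEq] at hc
    exact hc.1.symm
  · intro hr
    obtain ⟨c, hc⟩ := h r
    have := mem_roots_of_apply hc
    rwa [hr] at this

theorem Lifts.zero_eq {E : RepMap n} {p : MinMap n} (h : E.Lifts p) : E.zero = ∅ := by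
  rw [eq_empty_iff_forall_notMem]
  intro u hu
  obtain ⟨c, hc⟩ := h.apply u
  rw [mem_zero, hc] at hu
  simp at hu

theorem Lifts.join {E : RepMap n} {p : MinMap n} (h : E.Lifts p) {a b : Fin n} (c : Bool)
    (ha : a ∈ E.roots) (hab : a < b) : (E.join (a, c) b).Lifts (p.merge a b) := by
  intro i
  have ha' : p a = a := by rwa [h.roots_eq, MinMap.mem_roots] at ha
  obtain ⟨e, he⟩ := h i
  rw [join_apply ha hab, he, MinMap.merge_apply ha' hab]
  by_cases hi : p i = b <;> cases e <;> simp [hi, bar]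

theorem Lifts.card_zero_sign {E : RepMap n} {p : MinMap n} (h : E.Lifts p) (a : Fin n) :
    (E.sign a).zero.card = 2 * (p.fiber a).card := by
  have : (E.sign a).zero = p.fiber a ×ˢ univ := by
    ext u
    obtain ⟨c, hc⟩ := h.apply u
    rw [mem_zero, sign_apply_eq_none, mem_product, MinMap.mem_fiber, hc]
    simp
  rw [this, card_product]
  simp [mul_comm]

end RepMap

namespace LabeledPartition

variable {n : ℕ} {Sg : Type*} [Fintype Sg] [LinearOrder Sg] [Subsingleton Sg]
  {d : Prop} {hn : 0 < n} {σ : Sg}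

open Classical in
/-- The number of ways to complete an unsigned partition with blocks given by `p` to `[n]_σ` by a
sequence of signed edges. -/
noncomputable def signedCompletions (d : Prop) (p : MinMap n) : ℕ :=
  (p.roots.filter fun r => d → (p.fiber r).card ≠ 1).card * (p.roots.card - 1)!

/-- The hypothesis `hl'` is the invariant that makes the bound `l` forgettable: a noncoherent join
with smaller root `a` respects `l` exactly when it is admissible for `p`. The successors that matter
are the admissible noncoherent joins, which match the recursive terms of `mergeSum`, and the first
signed edges, which give the term `signedCompletions`. -/
theorem encard_chainsFrom_unsigned {x : LabeledPartition n Sg} {p : MinMap n} {l : ℕ ×ₗ ℕ}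
    (hp : x.repMap.Lifts p) (hl : toLex (1, 1) ≤ l)
    (hl' : ∀ a, p a = a →
      ((toLex (2, (a : ℕ) + 1) : ℕ ×ₗ ℕ) ≤ l ↔ ∀ i, p i ≠ i → a ≤ p i)) :
    (chainsFrom (subposet n Sg d) (full n hn σ : LabeledPartition n Sg) l x).encard =
      (MinMap.mergeSum (signedCompletions d) p : ℕ) := by
  classical
  induction hk : p.roots.card using Nat.strong_induction_on generalizing x p l with
  | _ k ih =>
  have hx : (x : LabeledPartitionPoset n Sg) ∈ subposet n Sg d := by
    rw [coe_mem_subposet, hp.zero_eq]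
    simp
  have hroots := hp.roots_eq
  have hmem : ∀ a, a ∈ x.repMap.roots ↔ p a = a := fun a => by rw [hroots, MinMap.mem_roots]
  have hne : x.repMap.roots.Nonempty := ⟨p ⟨0, hn⟩, by rw [hmem, p.idem]⟩
  have hjoin : ∀ {a b : Fin n}, (a, b) ∈ p.admissible →
      a ∈ x.repMap.roots ∧ b ∈ x.repMap.roots ∧ a < b ∧ ∀ i, p i ≠ i → a ≤ p i := by
    intro a b h
    rw [hmem, hmem]
    exact MinMap.mem_admissible.1 h
  have hsmem : ∀ a, (ofRepMap σ (x.repMap.sign a) : LabeledPartitionPoset n Sg) ∈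
      subposet n Sg d ↔ (d → (p.fiber a).card ≠ 1) := by
    intro a
    rw [coe_mem_subposet, repMap_ofRepMap, hp.card_zero_sign]
    refine forall_congr' fun _ => not_congr ?_
    omega
  have hlabj : ∀ {a b : Fin n}, (a, b) ∈ p.admissible →
      edgeLabel (x : LabeledPartitionPoset n Sg)
        (ofRepMap σ (x.repMap.join (a, true) b) : LabeledPartition n Sg) =
      toLex (2, (a : ℕ) + 1) := by
    intro a b h
    obtain ⟨h1, h2, h3, -⟩ := hjoin h
    rw [edgeLabel_join (w := (a, true)) h1 h2 h3 (repMap_ofRepMap _ _)]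
    rfl
  have hlabs : ∀ a ∈ x.repMap.roots, edgeLabel (x : LabeledPartitionPoset n Sg)
      (ofRepMap σ (x.repMap.sign a) : LabeledPartition n Sg) = toLex (1, 1) := fun a ha =>
    edgeLabel_sign σ ha (repMap_ofRepMap _ _)
  set S := p.roots.filter fun r => d → (p.fiber r).card ≠ 1 with hS
  have hmemS : ∀ a, a ∈ S ↔ a ∈ x.repMap.roots ∧ (d → (p.fiber a).card ≠ 1) := fun a => by
    rw [hS, mem_filter, hroots]
  rw [encard_chainsFrom_eq_sum (X := ⟨x, hx⟩) (coe_ne_full hne) (p.admissible.disjSum S)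
    (Sum.elim
      (fun e => ((ofRepMap σ (x.repMap.join (e.1, true) e.2) : LabeledPartition n Sg) :
        LabeledPartitionPoset n Sg))
      (fun a => ((ofRepMap σ (x.repMap.sign a) : LabeledPartition n Sg) :
        LabeledPartitionPoset n Sg)))]
  · rw [sum_disjSum, MinMap.mergeSum_eq, add_comm, Nat.cast_add, Nat.cast_sum]
    congr 1
    · rw [sum_congr rfl (g := fun _ => (((p.roots.card - 1)! : ℕ) : ℕ∞))]
      · rw [sum_const, signedCompletions]
        simp [hS]
      · intro a ha
        obtain ⟨ha, ha'⟩ := (hmemS a).1 ha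
        simp only [Sum.elim_inr]
        rw [hlabs a ha, encard_chainsFrom_signed ((hsmem a).2 ha'), repMap_ofRepMap,
          RepMap.roots_sign, card_erase_of_mem ha, hroots]
        rw [repMap_ofRepMap]
        obtain ⟨u, hu, -⟩ := exists_of_ssubset (RepMap.zero_ssubset_zero_sign ha)
        exact ⟨u, hu⟩
    · refine sum_congr rfl ?_
      rintro ⟨a, b⟩ hab
      obtain ⟨h1, h2, h3, h4⟩ := hjoin hab
      have happ := MinMap.merge_apply ((hmem a).1 h1) h3
      simp only [Sum.elim_inl]
      rw [hlabj hab]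
      refine ih _ (hk ▸ MinMap.card_roots_merge_lt hab) ?_ ?_ ?_ rfl
      · rw [repMap_ofRepMap]
        exact hp.join true h1 h3
      · rw [toLex_le_toLex_iff]
        omega
      -- After the merge, `a` is itself the least element of a nonsingleton block and is at most all
      -- others, so being at most the last label is again admissibility.
      · intro a' _
        rw [toLex_le_toLex_iff]
        constructor
        · intro h i hi
          have h' : a' ≤ a := Fin.le_def.2 (by omega)
          refine h'.trans ?_
          rw [happ] at hi ⊢
          split_ifs at hi ⊢
          · exact le_rfl
          · exact h4 i hi
        · intro h
          have h5 := h b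
          rw [happ, if_pos ((hmem b).1 h2)] at h5
          have h6 := Fin.le_def.1 (h5 h3.ne)
          omega
  · have hz : ∀ {a b c : Fin n}, (a, b) ∈ p.admissible → c ∈ x.repMap.roots →
        x.repMap.join (a, true) b ≠ x.repMap.sign c := by
      intro a b c hab hc h
      obtain ⟨h1, -, h3, -⟩ := hjoin hab
      have h4 := RepMap.zero_ssubset_zero_sign hc
      rw [← h, RepMap.zero_join (w := (a, true)) h1 h3] at h4
      exact ssubset_irrefl _ h4
    have hinj : ∀ {E F : RepMap n}, ((ofRepMap σ E : LabeledPartition n Sg) :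
        LabeledPartitionPoset n Sg) = (ofRepMap σ F : LabeledPartition n Sg) → E = F := by
      intro E F h
      have h1 := congrArg repMap (WithTop.coe_injective h)
      rwa [repMap_ofRepMap, repMap_ofRepMap] at h1
    rintro (⟨a, b⟩ | c) hi (⟨a', b'⟩ | c') hj h
    · have hi := inl_mem_disjSum.1 (mem_coe.1 hi)
      have hj := inl_mem_disjSum.1 (mem_coe.1 hj)
      obtain ⟨h1, h2, h3, -⟩ := hjoin hi
      obtain ⟨h1', h2', h3', -⟩ := hjoin hj
      have h := hinj h
      have hr := RepMap.roots_join (w := (a, true)) h1 h3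
      have happ := RepMap.join_apply (w := (a, true)) h1 h3 (b, false)
      dsimp only at h
      rw [h, RepMap.roots_join (w := (a', true)) h1' h3'] at hr
      -- A join determines `b` as the root it loses, and then `a` as the new representative of `b`.
      have hbb : b = b' := by
        by_contra hne
        have : b ∈ x.repMap.roots.erase b' := mem_erase.2 ⟨hne, h2⟩
        rw [hr] at this
        simp at this
      subst hbb
      rw [h, RepMap.join_apply (w := (a', true)) h1' h3', RepMap.mem_roots.1 h2] at happ
      simp at happ
      rw [happ]
    · exact absurd (hinj h) (hz (inl_mem_disjSum.1 (mem_coe.1 hi))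
        ((hmemS _).1 (inr_mem_disjSum.1 (mem_coe.1 hj))).1)
    · exact absurd (hinj h).symm (hz (inl_mem_disjSum.1 (mem_coe.1 hj))
        ((hmemS _).1 (inr_mem_disjSum.1 (mem_coe.1 hi))).1)
    · exact congrArg Sum.inr (sign_injOn σ x.repMap
        ((hmemS _).1 (inr_mem_disjSum.1 (mem_coe.1 hi))).1
        ((hmemS _).1 (inr_mem_disjSum.1 (mem_coe.1 hj))).1 h)
  · rintro (⟨a, b⟩ | c) hi
    · have hab := inl_mem_disjSum.1 hi
      obtain ⟨h1, h2, h3, h4⟩ := hjoin hab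
      have hQ : ((ofRepMap σ (x.repMap.join (a, true) b) : LabeledPartition n Sg) :
          LabeledPartitionPoset n Sg) ∈ subposet n Sg d := by
        rw [coe_mem_subposet, repMap_ofRepMap, RepMap.zero_join (w := (a, true)) h1 h3]
        exact coe_mem_subposet.1 hx
      refine ⟨hQ, (covBy_iff σ).2 (Or.inl ⟨(a, true), b, h1, h2, h3, repMap_ofRepMap _ _⟩), ?_⟩
      simp only [Sum.elim_inl]
      rw [hlabj hab]
      exact (hl' a ((hmem a).1 h1)).2 h4
    · obtain ⟨h1, h2⟩ := (hmemS c).1 (inr_mem_disjSum.1 hi)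
      exact ⟨(hsmem c).2 h2, (covBy_iff σ).2 (Or.inr ⟨c, h1, repMap_ofRepMap _ _⟩),
        (hlabs c h1).le.trans hl⟩
  · rintro ⟨Y, hY⟩ hcov hle hcount
    induction Y using WithTop.recTopCoe with
    | top => exact absurd (encard_chainsFrom_top _ _ rfl) hcount
    | coe y =>
      rcases (covBy_iff σ).1 hcov with ⟨⟨a, c⟩, b, hw, hb, hwb, hy⟩ | ⟨a, ha, hy⟩
      · have hlab := edgeLabel_join hw hb hwb hy
        dsimp only at hle hcount hw hwb
        rw [hlab] at hle hcount
        cases c with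
        | false =>
          refine absurd (encard_chainsFrom_coherent _ hY ⟨a, ?_⟩) hcount
          rw [hy, RepMap.roots_join hw hwb]
          exact mem_erase.2 ⟨hwb.ne, hw⟩
        | true =>
          refine ⟨Sum.inl (a, b), inl_mem_disjSum.2 (MinMap.mem_admissible.2
            ⟨(hmem a).1 hw, (hmem b).1 hb, hwb, (hl' a ((hmem a).1 hw)).1 hle⟩), ?_⟩
          simp only [Sum.elim_inl]
          rw [repMap_injective ((repMap_ofRepMap σ _).trans hy.symm)]
      · have hyeq := repMap_injective ((repMap_ofRepMap σ _).trans hy.symm)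
        refine ⟨Sum.inr a, inr_mem_disjSum.2 ((hmemS a).2 ⟨ha, ?_⟩), ?_⟩
        · rw [← hsmem, hyeq]
          exact hY
        · simp only [Sum.elim_inr]
          rw [hyeq]

theorem encard_decreasingMaximalChains (d : Prop) (hn : 0 < n) (σ : Sg) :
    (decreasingMaximalChains (subposet n Sg d) (finest n Sg) (full n hn σ)).encard =
      (MinMap.mergeSum (signedCompletions d) (MinMap.discrete n) : ℕ) := by
  -- At the start no bound is imposed, so any upper bound of the finitely many labels serves. It is
  -- raised to at least `(2, n)`, so that every root passes the test, as admissibility demands when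
  -- all blocks are singletons.
  obtain ⟨l, hl⟩ := (Set.finite_range fun e : LabeledPartitionPoset n Sg ×
    LabeledPartitionPoset n Sg => edgeLabel e.1 e.2).bddAbove
  have hmax : (toLex (2, n) : ℕ ×ₗ ℕ) ≤ max l (toLex (2, n)) := le_max_right _ _
  rw [← encard_chainsFrom_unsigned (x := finest n Sg) (hn := hn) (σ := σ)
    (l := max l (toLex (2, n)))]
  · congr 1
    ext c
    simp only [decreasingMaximalChains, chainsFrom, Set.mem_ofPred_eq, List.pairwise_cons]
    have h : ∀ a ∈ labelWord (c.map Subtype.val), max l (toLex (2, n)) ≥ a := by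
      intro a ha
      rw [labelWord, ← List.map_uncurry_zip_eq_zipWith] at ha
      obtain ⟨e, -, rfl⟩ := List.mem_map.1 ha
      exact (hl ⟨e, rfl⟩).trans (le_max_left _ _)
    tauto
  · exact fun i => ⟨false, repMap_finest _⟩
  · refine le_trans ?_ hmax
    rw [toLex_le_toLex_iff]
    omega
  · intro a _
    refine ⟨fun _ i hi => absurd rfl hi, fun _ => le_trans ?_ hmax⟩
    rw [toLex_le_toLex_iff]
    have := a.2
    omega

end LabeledPartition

theorem mainTheorem9 {Sg : Type*} [Fintype Sg] [LinearOrder Sg] (hm : Fintype.card Sg = 1)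
    (σ : Sg) (n : ℕ) (hn : 0 < n) :
    (decreasingMaximalChains (typeB n σ) (LabeledPartition.finest n Sg)
        (LabeledPartition.full n hn σ)).encard =
      (partitionSum n fun π => (π.parts.card)! : ℕ) ∧
    (decreasingMaximalChains (typeC n Sg) (LabeledPartition.finest n Sg)
        (LabeledPartition.full n hn σ)).encard =
      (partitionSum n fun π => (π.parts.card)! : ℕ) ∧
    (decreasingMaximalChains (typeD n Sg) (LabeledPartition.finest n Sg)
        (LabeledPartition.full n hn σ)).encard =
      (partitionSum n fun π => numNonsingleton π * (π.parts.card - 1)! : ℕ) := by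
  have : Subsingleton Sg := Fintype.card_le_one_iff_subsingleton.1 hm.le
  have key : ∀ d f, (∀ p : MinMap n, f p.toFinpartition = LabeledPartition.signedCompletions d p) →
      (decreasingMaximalChains (LabeledPartition.subposet n Sg d) (LabeledPartition.finest n Sg)
        (LabeledPartition.full n hn σ)).encard = (partitionSum n f : ℕ) := by
    intro d f h
    rw [LabeledPartition.encard_decreasingMaximalChains, MinMap.partitionSum_eq, funext h]
  have hC : (decreasingMaximalChains (LabeledPartition.subposet n Sg False)
      (LabeledPartition.finest n Sg) (LabeledPartition.full n hn σ)).encard =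
      (partitionSum n fun π => (π.parts.card)! : ℕ) := by
    refine key _ _ fun p => ?_
    -- Without a restriction all `k` roots may be signed first, and `k * (k - 1)! = k!` needs `k ≠
    -- 0`.
    have hpos : p.roots.card ≠ 0 :=
      (card_pos.2 ⟨p ⟨0, hn⟩, MinMap.mem_roots.2 (p.idem _)⟩).ne'
    rw [MinMap.card_parts_toFinpartition, LabeledPartition.signedCompletions]
    simp [Nat.mul_factorial_pred hpos]
  refine ⟨?_, ?_, ?_⟩
  · rw [LabeledPartition.typeB_eq]
    exact hC
  · rw [LabeledPartition.typeC_eq]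
    exact hC
  · rw [LabeledPartition.typeD_eq σ]
    refine key _ _ fun p => ?_
    rw [MinMap.card_parts_toFinpartition, MinMap.numNonsingleton_toFinpartition,
      LabeledPartition.signedCompletions]
    simp
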